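/- Setting. Let $\mathcal G=(\mathcal V,\mathcal E)$ be a finite connected undirected simple graph with $N=|\mathcal V|$ agents, and let $\mathcal A$ be its set of $2|\mathcal E|$ arcs (each edge taken in both directions). For each agent $i$ let $g_i:\mathbb R^M\to\mathbb R$ be convex and differentiable and let $h_i:\mathbb R^M\to\mathbb R\cup\{+\infty\}$ be convex and Borel measurable (e.g. lower semicontinuous), with $\mathrm{dom}(h_i)=\{h_i<\infty\}$, and suppose $\|\nabla g_i(y)-\nabla g_i(v)\|\le P_i\|y-v\|$ for all $y,v\in\mathrm{dom}(h_i)$, where $P_i>0$. For $x=(x_i)_{i}\in\mathbb R^{NM}$ put $h(x)=\sum_i h_i(x_i)$, $f(x)=\sum_i (g_i(x_i)+h_i(x_i))$ and $\mathrm{dom}(h)=\{x: h(x)<\infty\}$. Assume that $\min_y\sum_i(g_i(y)+h_i(y))$ has an optimal solution $y^*$ (with finite value), let $x^*=(y^*,\dots,y^*)$, and assume that $\mathrm{dom}(h)$ is bounded. Matrices. $A_1,A_2\in\mathbb R^{2|\mathcal E|M\times NM}$ are given by $(A_1x)_{ij}=x_i$, $(A_2x)_{ij}=x_j$ for $(i,j)\in\mathcal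 A$; $A=[A_1;A_2]$, $B=[-I;-I]$, $M_+=A_1^T+A_2^T$. Let $\rho_{ij}>0$ for $(i,j)\in\mathcal A$, $\Xi=\mathrm{diag}\{\rho_{ij}\}$, $\Gamma=\mathrm{blkdg}[\Xi\otimes I_M,\Xi\otimes I_M]$; let $\omega_i\ge0$, $\Omega=\mathrm{diag}\{\omega_i\}\otimes I_M$, $\widetilde P=\mathrm{diag}\{P_i\}\otimes I_M$. Write $\|v\|_S^2=v^TSv$. Assume $2\Omega+M_+(\Xi\otimes I_M)M_+^T\succ 2\widetilde P$. Stochastic gradients. For each $i$, $\widetilde g_i(y,s)$ is a jointly measurable function, and $\xi^1,\xi^2,\dots$ are independent random vectors $\xi^r=(\xi^r_i)_{i\in\mathcal V}$ (for fixed $r$ the components may be dependent). Let $G(x)=(\nabla g_i(x_i))_i$ and $\widetilde G(x,\xi)=(\widetilde g_i(x_i,\xi_i))_i$. Assume, for all $r\ge1$, $\mathbb E[\widetilde g_i(y,\xi_i^r)]=\nabla g_i(y)$ for every $i$ and $y\in\mathrm{dom}(h_i)$, and $\mathbb E\|\widetilde G(x,\xi^r)-G(x)\|^2\le\sigma^2$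 for every $x\in\mathrm{dom}(h)$. Algorithm 1 on the static graph. Take deterministic $x^0\in\mathrm{dom}(h)$, $\lambda^0\in\mathbb R^{4|\mathcal E|M}$ with $B^T\lambda^0=0$ and $z^0=\tfrac12M_+^Tx^0$, and for $r\ge0$, with $\eta^{r+1}=\sqrt{r+1}$, let $$x^{r+1}=\arg\min_x\Big\{\langle\widetilde G(x^r,\xi^{r+1}),x-x^r\rangle+h(x)+\tfrac12\|Ax+Bz^r+\Gamma^{-1}\lambda^r\|_\Gamma^2+\tfrac12\|x-x^r\|^2_{\Omega+\eta^{r+1}I}\Big\},$$ $$z^{r+1}=\arg\min_z\tfrac12\|Ax^{r+1}+Bz+\Gamma^{-1}\lambda^r\|_\Gamma^2,\qquad \lambda^{r+1}=\lambda^r+\Gamma(Ax^{r+1}+Bz^{r+1}).$$ Theorem 4.2. Let $\rho>0$ and $$d_x=\sup_{\hat x,\tilde x\in\mathrm{dom}(h)}\|\hat x-\tilde x\|,\qquad d_z=\sup_{\hat x,\tilde x\in\mathrm{dom}(h)}\sqrt{\sum_{(i,j)\in\mathcal A}2\rho_{ij}\|\hat x_i-\tilde x_j\|^2},\qquad d_\lambda(\rho)=\sup_{\|\lambda\|\le\rho}\|\lambda-\lambda^0\|_{\Gamma^{-1}}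 .$$ For $r\ge1$ let $\bar x^r=\frac1r\sum_{t=1}^r x^t$ and $\bar z^r=\frac1r\sum_{t=1}^r z^t$. Then $\bar x^r\in\mathrm{dom}(h)$, the random variable $f(\bar x^r)-f(x^*)+\rho\|A\bar x^r+B\bar z^r\|$ is integrable, and $$\mathbb E\big[f(\bar x^r)-f(x^*)+\rho\|A\bar x^r+B\bar z^r\|\big]\le\frac{\sigma^2}{\sqrt r}+\frac{d_x^2}{2\sqrt r}+\frac1{2r}\Big(d_z^2+d_\lambda(\rho)^2+\max_i\omega_i\,d_x^2\Big).$$ -/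

import Mathlib

open MeasureTheory ProbabilityTheory
open scoped Matrix Kronecker

noncomputable section

namespace DySPGC

/-! ### Stacked vectors

`V` is the set of agents and `ℝ^M` the space of the consensus variable. Stacked vectors are
indexed by `V × Fin M` (one block per agent), `G.Dart × Fin M` (one block per directed arc) and
two copies of the latter (multipliers). -/

/-- The `i`-th block `x_i ∈ ℝ^M` of a stacked vector, with its Euclidean structure. -/
def blk {I : Type*} {M : ℕ} (x : I × Fin M → ℝ) (i : I) : EuclideanSpace ℝ (Fin M) :=
  WithLp.toLp 2 (fun k => x (i, k))

/-- The Euclidean norm of a finite real vector. -/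
def l2norm {I : Type*} [Fintype I] (v : I → ℝ) : ℝ := ‖WithLp.toLp 2 v‖

/-- `‖v‖_S² = vᵀ S v`. -/
def wsq {I : Type*} [Fintype I] (S : Matrix I I ℝ) (v : I → ℝ) : ℝ := v ⬝ᵥ (S *ᵥ v)

/-- The stacked vector `(y, …, y)`. -/
def copies (V : Type*) {M : ℕ} (y : EuclideanSpace ℝ (Fin M)) : V × Fin M → ℝ := fun p => y p.2

/-! ### Extended-valued convex functions -/

/-- The effective domain of an extended-valued function. -/
def effDom {E : Type*} (h : E → EReal) : Set E := {y | h y < ⊤}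

/-- Convexity of an extended-valued function: its epigraph is convex. -/
def EConvex {E : Type*} [AddCommGroup E] [Module ℝ E] (h : E → EReal) : Prop :=
  Convex ℝ {p : E × ℝ | h p.1 ≤ (p.2 : EReal)}

/-! ### The objective -/

section Objective

variable {V : Type*} [Fintype V] {M : ℕ}

/-- `h(x) = ∑ h_i(x_i)` on stacked vectors. -/
def hSum (h : V → EuclideanSpace ℝ (Fin M) → EReal) (x : V × Fin M → ℝ) : EReal :=
  ∑ i, h i (blk x i)

/-- The objective `f(x) = ∑ (g_i(x_i) + h_i(x_i))` on stacked vectors. -/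
def fSum (g : V → EuclideanSpace ℝ (Fin M) → ℝ) (h : V → EuclideanSpace ℝ (Fin M) → EReal)
    (x : V × Fin M → ℝ) : EReal :=
  ∑ i, ((g i (blk x i) : EReal) + h i (blk x i))

/-- The solution set of `min_y ∑ (g_i(y) + h_i(y))`; the optimal value has to be finite. -/
def optSet (g : V → EuclideanSpace ℝ (Fin M) → ℝ) (h : V → EuclideanSpace ℝ (Fin M) → EReal) :
    Set (EuclideanSpace ℝ (Fin M)) :=
  {y | (∑ i, ((g i y : EReal) + h i y)) < ⊤ ∧
    ∀ v, (∑ i, ((g i y : EReal) + h i y)) ≤ ∑ i, ((g i v : EReal) + h i v)}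

/-- `G(x) = [∇g_1(x_1); …; ∇g_N(x_N)]`. -/
def gradVec (g : V → EuclideanSpace ℝ (Fin M) → ℝ) (x : V × Fin M → ℝ) : V × Fin M → ℝ :=
  fun p => gradient (g p.1) (blk x p.1) p.2

/-- The stacked gradient estimate `[g̃_1(x_1, s_1); …; g̃_N(x_N, s_N)]`. -/
def stochGrad {S : V → Type*} (gt : ∀ i, EuclideanSpace ℝ (Fin M) → S i → EuclideanSpace ℝ (Fin M))
    (x : V × Fin M → ℝ) (s : ∀ i, S i) : V × Fin M → ℝ :=
  fun p => gt p.1 (blk x p.1) (s p.1) p.2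

end Objective

/-! ### The matrices of the network -/

section Network

variable {V : Type*} [Fintype V] [DecidableEq V] (G : SimpleGraph V) [DecidableRel G.Adj] (M : ℕ)

/-- `A₁`: the block in row `(i, j)` and column `i` is the identity. -/
def A₁ : Matrix (G.Dart × Fin M) (V × Fin M) ℝ :=
  Matrix.of fun e p => if e.1.fst = p.1 ∧ e.2 = p.2 then 1 else 0

/-- `A₂`: the block in row `(i, j)` and column `j` is the identity. -/
def A₂ : Matrix (G.Dart × Fin M) (V × Fin M) ℝ :=
  Matrix.of fun e p => if e.1.snd = p.1 ∧ e.2 = p.2 then 1 else 0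

/-- `A = [A₁; A₂]`. -/
def A : Matrix ((G.Dart × Fin M) ⊕ (G.Dart × Fin M)) (V × Fin M) ℝ :=
  Matrix.fromRows (A₁ G M) (A₂ G M)

/-- `B = [-I; -I]`. -/
def B : Matrix ((G.Dart × Fin M) ⊕ (G.Dart × Fin M)) (G.Dart × Fin M) ℝ :=
  Matrix.fromRows (-1) (-1)

/-- `M₊ = A₁ᵀ + A₂ᵀ`. -/
def Mplus : Matrix (V × Fin M) (G.Dart × Fin M) ℝ := (A₁ G M)ᵀ + (A₂ G M)ᵀ

variable {G}

/-- `Ξ ⊗ I_M`, where `Ξ` is the diagonal matrix of the penalties `ρ_{ij}`, one for each arc. -/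
def XiI (pen : G.Dart → ℝ) : Matrix (G.Dart × Fin M) (G.Dart × Fin M) ℝ :=
  Matrix.diagonal pen ⊗ₖ (1 : Matrix (Fin M) (Fin M) ℝ)

/-- `Γ = blkdg[Ξ ⊗ I_M, Ξ ⊗ I_M]`. -/
def Gam (pen : G.Dart → ℝ) :
    Matrix ((G.Dart × Fin M) ⊕ (G.Dart × Fin M)) ((G.Dart × Fin M) ⊕ (G.Dart × Fin M)) ℝ :=
  Matrix.fromBlocks (XiI M pen) 0 0 (XiI M pen)

/-- `diag{c_1, …, c_N} ⊗ I_M`; this is `Ω` for `c = ω` and `P̃` for `c = P`. -/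
def nodeDiag (c : V → ℝ) : Matrix (V × Fin M) (V × Fin M) ℝ :=
  Matrix.diagonal c ⊗ₖ (1 : Matrix (Fin M) (Fin M) ℝ)

end Network

/-! ### The algorithm on a static graph -/

section Algorithm

variable {V : Type*} [Fintype V] [DecidableEq V] {G : SimpleGraph V} [DecidableRel G.Adj] {M : ℕ}

/-- The function that the `x`-update minimizes: `Gt` is the gradient estimate, `(x', z', l')` the
current iterate, `eta` the additional proximal weight of the step. -/
def xObj (h : V → EuclideanSpace ℝ (Fin M) → EReal) (pen : G.Dart → ℝ) (om : V → ℝ) (eta : ℝ)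
    (Gt x' : V × Fin M → ℝ) (z' : G.Dart × Fin M → ℝ)
    (l' : (G.Dart × Fin M) ⊕ (G.Dart × Fin M) → ℝ) (x : V × Fin M → ℝ) : EReal :=
  hSum h x +
    ((Gt ⬝ᵥ (x - x')
      + 1 / 2 * wsq (Gam M pen) (A G M *ᵥ x + B G M *ᵥ z' + (Gam M pen)⁻¹ *ᵥ l')
      + 1 / 2 * wsq (nodeDiag M om + eta • (1 : Matrix (V × Fin M) (V × Fin M) ℝ)) (x - x') : ℝ) :
      EReal)

/-- The function that the `z`-update minimizes. -/
def zObj (pen : G.Dart → ℝ) (x : V × Fin M → ℝ)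
    (l' : (G.Dart × Fin M) ⊕ (G.Dart × Fin M) → ℝ) (z : G.Dart × Fin M → ℝ) : ℝ :=
  1 / 2 * wsq (Gam M pen) (A G M *ᵥ x + B G M *ᵥ z + (Gam M pen)⁻¹ *ᵥ l')

/-- `(x^r, z^r, λ^r)` is a run of the dynamic stochastic proximal-gradient consensus algorithm on
the static graph `G`, started at `(x0, z0, l0)` and driven by the samples `xi 1, xi 2, …`. -/
structure IsRun {Ω : Type*} {S : V → Type*}
    (h : V → EuclideanSpace ℝ (Fin M) → EReal)
    (gt : ∀ i, EuclideanSpace ℝ (Fin M) → S i → EuclideanSpace ℝ (Fin M))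
    (pen : G.Dart → ℝ) (om : V → ℝ) (eta : ℕ → ℝ) (xi : ℕ → Ω → ∀ i, S i)
    (x0 : V × Fin M → ℝ) (z0 : G.Dart × Fin M → ℝ)
    (l0 : (G.Dart × Fin M) ⊕ (G.Dart × Fin M) → ℝ)
    (x : ℕ → Ω → V × Fin M → ℝ) (z : ℕ → Ω → G.Dart × Fin M → ℝ)
    (l : ℕ → Ω → (G.Dart × Fin M) ⊕ (G.Dart × Fin M) → ℝ) : Prop where
  init_dual : (B G M)ᵀ *ᵥ l0 = 0
  init_link : z0 = (1 / 2 : ℝ) • ((Mplus G M)ᵀ *ᵥ x0)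
  x_zero : ∀ w, x 0 w = x0
  z_zero : ∀ w, z 0 w = z0
  l_zero : ∀ w, l 0 w = l0
  x_step : ∀ r w, IsMinOn
    (xObj h pen om (eta (r + 1)) (stochGrad gt (x r w) (xi (r + 1) w)) (x r w) (z r w) (l r w))
    Set.univ (x (r + 1) w)
  z_step : ∀ r w, IsMinOn (zObj pen (x (r + 1) w) (l r w)) Set.univ (z (r + 1) w)
  l_step : ∀ r w, l (r + 1) w =
    l r w + Gam M pen *ᵥ (A G M *ᵥ x (r + 1) w + B G M *ᵥ z (r + 1) w)

end Algorithm

/-- The ergodic average `(1/r) ∑_{t=1}^{r} u^t`. -/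
def avg {Ω I : Type*} (u : ℕ → Ω → I → ℝ) (r : ℕ) (w : Ω) : I → ℝ :=
  (1 / (r : ℝ)) • ∑ t ∈ Finset.Icc 1 r, u t w

/-! ### The constants of the bound -/

section Constants

variable {V : Type*} [Fintype V] [DecidableEq V] {G : SimpleGraph V} [DecidableRel G.Adj] {M : ℕ}

/-- `d_x`: the diameter of a set of stacked vectors. -/
def dX (D : Set (V × Fin M → ℝ)) : ℝ :=
  sSup {d | ∃ a ∈ D, ∃ b ∈ D, d = l2norm (a - b)}

/-- `d_z = sup sqrt(∑_{(i,j)} 2 ρ_{ij} ‖a_i - b_j‖²)` over `a, b` in a set of stacked vectors. -/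
def dZ (pen : G.Dart → ℝ) (D : Set (V × Fin M → ℝ)) : ℝ :=
  sSup {d | ∃ a ∈ D, ∃ b ∈ D,
    d = Real.sqrt (∑ e : G.Dart, 2 * pen e * ‖blk a e.fst - blk b e.snd‖ ^ 2)}

/-- `d_λ(ρ)`: the largest `Γ⁻¹`-distance from `λ⁰` to a point of the ball of radius `ρ`. -/
def dLam (pen : G.Dart → ℝ) (l0 : (G.Dart × Fin M) ⊕ (G.Dart × Fin M) → ℝ) (rho : ℝ) : ℝ :=
  sSup {d | ∃ l : (G.Dart × Fin M) ⊕ (G.Dart × Fin M) → ℝ,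
    l2norm l ≤ rho ∧ d = Real.sqrt (wsq (Gam M pen)⁻¹ (l - l0))}

end Constants

/-- The gap `f(x) - f(x*) + ρ ‖A x + B z‖`, where `x* = (y*, …, y*)`. -/
def gap {V : Type*} [Fintype V] [DecidableEq V] (G : SimpleGraph V) [DecidableRel G.Adj] {M : ℕ}
    (g : V → EuclideanSpace ℝ (Fin M) → ℝ) (h : V → EuclideanSpace ℝ (Fin M) → EReal)
    (rho : ℝ) (ystar : EuclideanSpace ℝ (Fin M)) (x : V × Fin M → ℝ) (z : G.Dart × Fin M → ℝ) : ℝ :=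
  (fSum g h x).toReal - (fSum g h (copies V ystar)).toReal
    + rho * l2norm (A G M *ᵥ x + B G M *ᵥ z)

end DySPGC

end

set_option linter.unusedSectionVars false

namespace DySPGC

/-! ### Coordinate forms of the network matrices and of the update objectives. -/

section Matrices

variable {V : Type*} [Fintype V] [DecidableEq V] {G : SimpleGraph V} [DecidableRel G.Adj] {M : ℕ}

/-! Each new iterate is compared with x* = (y*, …, y*). Optimality of the x-update controls h; the
descent inequality and convexity control the g_i. For every multiplier `lam`, the gap f(x^{r+1}) -
f(x*) + ⟨lam, A x^{r+1} + B z^{r+1}⟩ is then at most a noise term plus differences of consecutive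
squared distances (`IsRun.step_estimate`). This works because the two halves of λ^r stay opposite
and z^r averages the ends of each arc. The three-point identity in z then leaves -∑ ρ_{ij} ‖z^{r+1}
- z^r‖², a quarter of the quadratic form of M₊(Ξ ⊗ I)M₊ᵀ. Together with Ω/2 from the proximal term
it absorbs the curvature P̃/2 under the step-size condition. The η-part of the proximal term absorbs
⟨noise, x^{r+1} - x^r⟩ by Young's inequality, at the price ‖noise‖²/(2η).

Summing over the steps, the distances in Γ⁻¹, z and Ω telescope, the η-weighted ones are summed by
parts, and ∑ 1/(2√t) ≤ √r. Jensen passes to the averages (`gap_avg_le_sum`). There `lam` is aligned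
with the residual of the averages, which produces ρ‖A x̄ + B z̄‖; it may depend on the path, because
the noise terms do not contain it (`IsRun.gap_avg_le`).

For the expectation, x^t is independent of ξ^{t+1}. By Fubini the error has mean zero against x^t -
x* and second moment at most σ². The run is given only pathwise through minimizers, so measurability
has to be proved: strong convexity makes x^{t+1} a Lipschitz function of the linear term of its
objective (`IsRun.dist_x_succ_le`). Integrability of the gap also needs a lower bound, which comes
from the minimum attained in the first x-update (`IsRun.exists_le_fSum`). -/

theorem wsq_diagonal {I : Type*} [Fintype I] [DecidableEq I] (d v : I → ℝ) :
    wsq (Matrix.diagonal d) v = ∑ i, d i * v i ^ 2 := by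
  simp only [wsq, dotProduct, Matrix.mulVec_diagonal]
  exact Finset.sum_congr rfl fun i _ => by ring

theorem A₁_mulVec (x : V × Fin M → ℝ) (e : G.Dart × Fin M) :
    (A₁ G M *ᵥ x) e = x (e.1.fst, e.2) := by
  simp only [Matrix.mulVec, dotProduct, A₁, Matrix.of_apply, ite_mul, one_mul, zero_mul]
  rw [Finset.sum_eq_single (e.1.fst, e.2)] <;> simp +contextual [Prod.ext_iff, eq_comm]

theorem A₂_mulVec (x : V × Fin M → ℝ) (e : G.Dart × Fin M) :
    (A₂ G M *ᵥ x) e = x (e.1.snd, e.2) := by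
  simp only [Matrix.mulVec, dotProduct, A₂, Matrix.of_apply, ite_mul, one_mul, zero_mul]
  rw [Finset.sum_eq_single (e.1.snd, e.2)] <;> simp +contextual [Prod.ext_iff, eq_comm]

theorem A_mulVec_inl (x : V × Fin M → ℝ) (e : G.Dart × Fin M) :
    (A G M *ᵥ x) (.inl e) = x (e.1.fst, e.2) := by
  rw [A, Matrix.fromRows_mulVec, Sum.elim_inl, A₁_mulVec]

theorem A_mulVec_inr (x : V × Fin M → ℝ) (e : G.Dart × Fin M) :
    (A G M *ᵥ x) (.inr e) = x (e.1.snd, e.2) := by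
  rw [A, Matrix.fromRows_mulVec, Sum.elim_inr, A₂_mulVec]

theorem B_mulVec_inl (z : G.Dart × Fin M → ℝ) (e : G.Dart × Fin M) :
    (B G M *ᵥ z) (.inl e) = - z e := by
  rw [B, Matrix.fromRows_mulVec, Sum.elim_inl, Matrix.neg_mulVec, Matrix.one_mulVec, Pi.neg_apply]

theorem B_mulVec_inr (z : G.Dart × Fin M → ℝ) (e : G.Dart × Fin M) :
    (B G M *ᵥ z) (.inr e) = - z e := by
  rw [B, Matrix.fromRows_mulVec, Sum.elim_inr, Matrix.neg_mulVec, Matrix.one_mulVec, Pi.neg_apply]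

theorem B_transpose_mulVec (l : (G.Dart × Fin M) ⊕ (G.Dart × Fin M) → ℝ) (e : G.Dart × Fin M) :
    ((B G M)ᵀ *ᵥ l) e = - (l (.inl e) + l (.inr e)) := by
  rw [Matrix.mulVec_transpose, B, Matrix.vecMul_fromRows]
  simp [Matrix.vecMul_neg, add_comm]

theorem Mplus_transpose_mulVec (x : V × Fin M → ℝ) (e : G.Dart × Fin M) :
    ((Mplus G M)ᵀ *ᵥ x) e = x (e.1.fst, e.2) + x (e.1.snd, e.2) := by
  rw [Mplus, Matrix.transpose_add, Matrix.transpose_transpose, Matrix.transpose_transpose,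
    Matrix.add_mulVec, Pi.add_apply, A₁_mulVec, A₂_mulVec]

theorem XiI_eq_diagonal (pen : G.Dart → ℝ) :
    XiI M pen = Matrix.diagonal fun e : G.Dart × Fin M => pen e.1 := by
  rw [XiI, ← Matrix.diagonal_one, Matrix.diagonal_kronecker_diagonal]
  simp

theorem nodeDiag_eq_diagonal (c : V → ℝ) :
    nodeDiag M c = Matrix.diagonal fun p : V × Fin M => c p.1 := by
  rw [nodeDiag, ← Matrix.diagonal_one, Matrix.diagonal_kronecker_diagonal]
  simp

theorem Gam_eq_diagonal (pen : G.Dart → ℝ) :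
    Gam M pen = Matrix.diagonal
      (Sum.elim (fun e : G.Dart × Fin M => pen e.1) (fun e : G.Dart × Fin M => pen e.1)) := by
  rw [Gam, XiI_eq_diagonal, Matrix.fromBlocks_diagonal]

theorem inv_Gam_eq_diagonal {pen : G.Dart → ℝ} (hpen : ∀ e, 0 < pen e) :
    (Gam M pen)⁻¹ = Matrix.diagonal
      (Sum.elim (fun e : G.Dart × Fin M => (pen e.1)⁻¹) (fun e : G.Dart × Fin M => (pen e.1)⁻¹)) := by
  refine Matrix.inv_eq_left_inv ?_
  rw [Gam_eq_diagonal, Matrix.diagonal_mul_diagonal, ← Matrix.diagonal_one]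
  congr 1
  ext (e | e) <;> simp [(hpen e.1).ne']

theorem wsq_Gam (pen : G.Dart → ℝ) (u : (G.Dart × Fin M) ⊕ (G.Dart × Fin M) → ℝ) :
    wsq (Gam M pen) u = ∑ e, pen e.1 * (u (.inl e) ^ 2 + u (.inr e) ^ 2) := by
  rw [Gam_eq_diagonal, wsq_diagonal, Fintype.sum_sum_type]
  simp [mul_add, Finset.sum_add_distrib]

theorem wsq_inv_Gam {pen : G.Dart → ℝ} (hpen : ∀ e, 0 < pen e)
    (u : (G.Dart × Fin M) ⊕ (G.Dart × Fin M) → ℝ) :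
    wsq (Gam M pen)⁻¹ u = ∑ e, (pen e.1)⁻¹ * (u (.inl e) ^ 2 + u (.inr e) ^ 2) := by
  rw [inv_Gam_eq_diagonal hpen, wsq_diagonal, Fintype.sum_sum_type]
  simp [mul_add, Finset.sum_add_distrib]

theorem wsq_nodeDiag_add (om : V → ℝ) (eta : ℝ) (v : V × Fin M → ℝ) :
    wsq (nodeDiag M om + eta • (1 : Matrix (V × Fin M) (V × Fin M) ℝ)) v
      = ∑ p, (om p.1 + eta) * v p ^ 2 := by
  rw [nodeDiag_eq_diagonal, ← Matrix.diagonal_one, ← Matrix.diagonal_smul, Matrix.diagonal_add,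
    wsq_diagonal]
  simp

/-- The objective of the `z`-update, written as a sum over the arcs. -/
theorem zObj_eq_sum {pen : G.Dart → ℝ} (hpen : ∀ e, 0 < pen e) (x : V × Fin M → ℝ)
    (l : (G.Dart × Fin M) ⊕ (G.Dart × Fin M) → ℝ) (z : G.Dart × Fin M → ℝ) :
    zObj pen x l z = 1 / 2 * ∑ e, pen e.1 *
      ((x (e.1.fst, e.2) - z e + (pen e.1)⁻¹ * l (.inl e)) ^ 2
        + (x (e.1.snd, e.2) - z e + (pen e.1)⁻¹ * l (.inr e)) ^ 2) := by
  rw [zObj, wsq_Gam, inv_Gam_eq_diagonal hpen]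
  simp [A_mulVec_inl, A_mulVec_inr, B_mulVec_inl, B_mulVec_inr, Matrix.mulVec_diagonal,
    sub_eq_add_neg]

/-- The smooth part of the objective of the `x`-update, written with sums. -/
noncomputable def xQuad (pen : G.Dart → ℝ) (om : V → ℝ) (eta : ℝ) (Gt x' : V × Fin M → ℝ)
    (z' : G.Dart × Fin M → ℝ) (l' : (G.Dart × Fin M) ⊕ (G.Dart × Fin M) → ℝ)
    (x : V × Fin M → ℝ) : ℝ :=
  ∑ p, Gt p * (x p - x' p)
    + 1 / 2 * (∑ e : G.Dart × Fin M, pen e.1 *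
      ((x (e.1.fst, e.2) - z' e + (pen e.1)⁻¹ * l' (.inl e)) ^ 2
        + (x (e.1.snd, e.2) - z' e + (pen e.1)⁻¹ * l' (.inr e)) ^ 2))
    + 1 / 2 * ∑ p, (om p.1 + eta) * (x p - x' p) ^ 2

theorem xObj_eq_xQuad {pen : G.Dart → ℝ} (hpen : ∀ e, 0 < pen e)
    (h : V → EuclideanSpace ℝ (Fin M) → EReal) (om : V → ℝ) (eta : ℝ) (Gt x' : V × Fin M → ℝ)
    (z' : G.Dart × Fin M → ℝ) (l' : (G.Dart × Fin M) ⊕ (G.Dart × Fin M) → ℝ)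
    (x : V × Fin M → ℝ) :
    xObj h pen om eta Gt x' z' l' x
      = hSum h x + (xQuad pen om eta Gt x' z' l' x : EReal) := by
  rw [xObj, wsq_nodeDiag_add, wsq_Gam, inv_Gam_eq_diagonal hpen, xQuad]
  simp [A_mulVec_inl, A_mulVec_inr, B_mulVec_inl, B_mulVec_inr, Matrix.mulVec_diagonal,
    sub_eq_add_neg, dotProduct]

/-- The derivative of `xQuad` at `x` in the direction `d`. -/
noncomputable def xSlope (pen : G.Dart → ℝ) (om : V → ℝ) (eta : ℝ) (Gt x' : V × Fin M → ℝ)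
    (z' : G.Dart × Fin M → ℝ) (l' : (G.Dart × Fin M) ⊕ (G.Dart × Fin M) → ℝ)
    (x d : V × Fin M → ℝ) : ℝ :=
  ∑ p, Gt p * d p
    + (∑ e : G.Dart × Fin M,
      ((pen e.1 * (x (e.1.fst, e.2) - z' e) + l' (.inl e)) * d (e.1.fst, e.2)
        + (pen e.1 * (x (e.1.snd, e.2) - z' e) + l' (.inr e)) * d (e.1.snd, e.2)))
    + ∑ p, (om p.1 + eta) * (x p - x' p) * d p

/-- A quadratic equals its second-order expansion along every line, so the first-order condition
needs no differentiation. -/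
theorem xQuad_add_smul {pen : G.Dart → ℝ} (hpen : ∀ e, 0 < pen e) (om : V → ℝ) (eta : ℝ)
    (Gt x' : V × Fin M → ℝ) (z' : G.Dart × Fin M → ℝ)
    (l' : (G.Dart × Fin M) ⊕ (G.Dart × Fin M) → ℝ) (x d : V × Fin M → ℝ) (t : ℝ) :
    xQuad pen om eta Gt x' z' l' (x + t • d)
      = xQuad pen om eta Gt x' z' l' x + t * xSlope pen om eta Gt x' z' l' x d
        + t ^ 2 * (1 / 2 * (∑ e : G.Dart × Fin M, pen e.1 *
            (d (e.1.fst, e.2) ^ 2 + d (e.1.snd, e.2) ^ 2))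
          + 1 / 2 * ∑ p, (om p.1 + eta) * d p ^ 2) := by
  have h₁ : ∑ p, Gt p * (x p + t * d p - x' p)
      = ∑ p, Gt p * (x p - x' p) + t * ∑ p, Gt p * d p := by
    rw [Finset.mul_sum, ← Finset.sum_add_distrib]
    exact Finset.sum_congr rfl fun p _ => by ring
  have h₂ : ∑ e : G.Dart × Fin M, pen e.1 *
        ((x (e.1.fst, e.2) + t * d (e.1.fst, e.2) - z' e + (pen e.1)⁻¹ * l' (.inl e)) ^ 2
          + (x (e.1.snd, e.2) + t * d (e.1.snd, e.2) - z' e + (pen e.1)⁻¹ * l' (.inr e)) ^ 2)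
      = ∑ e : G.Dart × Fin M, pen e.1 *
        ((x (e.1.fst, e.2) - z' e + (pen e.1)⁻¹ * l' (.inl e)) ^ 2
          + (x (e.1.snd, e.2) - z' e + (pen e.1)⁻¹ * l' (.inr e)) ^ 2)
      + 2 * t * (∑ e : G.Dart × Fin M,
        ((pen e.1 * (x (e.1.fst, e.2) - z' e) + l' (.inl e)) * d (e.1.fst, e.2)
          + (pen e.1 * (x (e.1.snd, e.2) - z' e) + l' (.inr e)) * d (e.1.snd, e.2)))
      + t ^ 2 * ∑ e : G.Dart × Fin M, pen e.1 *
            (d (e.1.fst, e.2) ^ 2 + d (e.1.snd, e.2) ^ 2) := by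
    rw [Finset.mul_sum, Finset.mul_sum, ← Finset.sum_add_distrib, ← Finset.sum_add_distrib]
    refine Finset.sum_congr rfl fun e _ => ?_
    have := (hpen e.1).ne'
    field_simp
    ring
  have h₃ : ∑ p, (om p.1 + eta) * (x p + t * d p - x' p) ^ 2
      = ∑ p, (om p.1 + eta) * (x p - x' p) ^ 2
        + 2 * t * ∑ p, (om p.1 + eta) * (x p - x' p) * d p
        + t ^ 2 * ∑ p, (om p.1 + eta) * d p ^ 2 := by
    rw [Finset.mul_sum, Finset.mul_sum, ← Finset.sum_add_distrib, ← Finset.sum_add_distrib]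
    exact Finset.sum_congr rfl fun p _ => by ring
  simp only [xQuad, xSlope, Pi.add_apply, Pi.smul_apply, smul_eq_mul]
  rw [h₁, h₂, h₃]
  ring

end Matrices

/-! ### Passing from extended-valued to real-valued functions. -/

section Extended

theorem ereal_sum_ne_bot {I : Type*} {s : Finset I} {a : I → EReal} (ha : ∀ i, a i ≠ ⊥) :
    ∑ i ∈ s, a i ≠ ⊥ := by
  classical
  induction s using Finset.induction_on with
  | empty => simp
  | insert i s hi ih => rw [Finset.sum_insert hi]; simp [EReal.add_eq_bot_iff, ha i, ih]

theorem ereal_sum_lt_top_iff {I : Type*} {s : Finset I} {a : I → EReal} (ha : ∀ i, a i ≠ ⊥) :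
    ∑ i ∈ s, a i < ⊤ ↔ ∀ i ∈ s, a i < ⊤ := by
  classical
  induction s using Finset.induction_on with
  | empty => simp
  | insert i s hi ih =>
    rw [Finset.sum_insert hi, Finset.forall_mem_insert, ← ih]
    simp only [lt_top_iff_ne_top]
    exact EReal.add_ne_top_iff_ne_top₂ (ha i) (ereal_sum_ne_bot ha)

theorem ereal_sum_toReal {I : Type*} {s : Finset I} {a : I → EReal} (ha : ∀ i, a i ≠ ⊥)
    (ht : ∀ i ∈ s, a i < ⊤) : (∑ i ∈ s, a i).toReal = ∑ i ∈ s, (a i).toReal := by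
  classical
  induction s using Finset.induction_on with
  | empty => simp
  | insert i s hi ih =>
    rw [Finset.forall_mem_insert] at ht
    rw [Finset.sum_insert hi, Finset.sum_insert hi, EReal.toReal_add ht.1.ne (ha i)
      ((ereal_sum_lt_top_iff ha).2 ht.2).ne (ereal_sum_ne_bot ha), ih ht.2]

theorem EConvex.convexOn_toReal {E : Type*} [AddCommGroup E] [Module ℝ E] {h : E → EReal}
    (hc : EConvex h) (hb : ∀ y, h y ≠ ⊥) : ConvexOn ℝ (effDom h) fun y => (h y).toReal := by
  have key : ∀ y ∈ effDom h, ∀ v ∈ effDom h, ∀ a b : ℝ, 0 ≤ a → 0 ≤ b → a + b = 1 →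
      h (a • y + b • v) ≤ ((a * (h y).toReal + b * (h v).toReal : ℝ) : EReal) := by
    intro y hy v hv a b ha hb' hab
    have := hc (x := (y, (h y).toReal)) (EReal.le_coe_toReal hy.ne)
      (y := (v, (h v).toReal)) (EReal.le_coe_toReal hv.ne) ha hb' hab
    simpa using this
  refine ⟨fun y hy v hv a b ha hb' hab => ?_, fun y hy v hv a b ha hb' hab => ?_⟩
  · exact (key y hy v hv a b ha hb' hab).trans_lt (EReal.coe_lt_top _)
  · have := EReal.toReal_le_toReal (key y hy v hv a b ha hb' hab) (hb _) (EReal.coe_ne_top _)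
    rwa [EReal.toReal_coe] at this

end Extended

/-! ### Domain and convexity of the stacked objective. -/

section Objective

variable {V : Type*} [Fintype V] {M : ℕ} {h : V → EuclideanSpace ℝ (Fin M) → EReal}
  {g : V → EuclideanSpace ℝ (Fin M) → ℝ}

theorem blk_add_smul {I : Type*} (x y : I × Fin M → ℝ) (a b : ℝ) (i : I) :
    blk (a • x + b • y) i = a • blk x i + b • blk y i := by
  ext k; simp [blk]

theorem mem_effDom_hSum (hb : ∀ i y, h i y ≠ ⊥) {x : V × Fin M → ℝ} :
    x ∈ effDom (hSum h) ↔ ∀ i, blk x i ∈ effDom (h i) := by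
  simp [effDom, hSum, ereal_sum_lt_top_iff (fun i => hb i (blk x i))]

theorem hSum_ne_bot (hb : ∀ i y, h i y ≠ ⊥) (x : V × Fin M → ℝ) : hSum h x ≠ ⊥ :=
  ereal_sum_ne_bot fun i => hb i _

theorem toReal_hSum (hb : ∀ i y, h i y ≠ ⊥) {x : V × Fin M → ℝ} (hx : x ∈ effDom (hSum h)) :
    (hSum h x).toReal = ∑ i, (h i (blk x i)).toReal :=
  ereal_sum_toReal (fun i => hb i _) fun i _ => (mem_effDom_hSum hb).1 hx i

/-- `EReal.toReal` sends `⊤` to `0`, so the real-valued form is meaningful only on the domain. -/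
theorem toReal_fSum (hb : ∀ i y, h i y ≠ ⊥) {x : V × Fin M → ℝ} (hx : x ∈ effDom (hSum h)) :
    (fSum g h x).toReal = ∑ i, g i (blk x i) + (hSum h x).toReal := by
  rw [mem_effDom_hSum hb] at hx
  have h₁ : ∀ i, (g i (blk x i) : EReal) + h i (blk x i) ≠ ⊥ := fun i => by
    simp [EReal.add_eq_bot_iff, hb]
  rw [toReal_hSum hb ((mem_effDom_hSum hb).2 hx), fSum, ereal_sum_toReal h₁,
    ← Finset.sum_add_distrib]
  · exact Finset.sum_congr rfl fun i _ => by
      rw [EReal.toReal_add (EReal.coe_ne_top _) (EReal.coe_ne_bot _) (hx i).ne (hb _ _),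
        EReal.toReal_coe]
  · exact fun i _ => EReal.add_lt_top (EReal.coe_ne_top _) (hx i).ne

theorem convexOn_hSum (hb : ∀ i y, h i y ≠ ⊥) (hc : ∀ i, EConvex (h i)) :
    ConvexOn ℝ (effDom (hSum h)) fun x => (hSum h x).toReal := by
  have hconv : Convex ℝ (effDom (hSum h)) := by
    intro x hx y hy a b ha hb' hab
    rw [mem_effDom_hSum hb] at *
    intro i
    rw [blk_add_smul]
    exact ((hc i).convexOn_toReal (hb i)).1 (hx i) (hy i) ha hb' hab
  refine ⟨hconv, fun x hx y hy a b ha hb' hab => ?_⟩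
  simp only
  rw [toReal_hSum hb (hconv hx hy ha hb' hab), toReal_hSum hb hx, toReal_hSum hb hy,
    smul_eq_mul, smul_eq_mul, Finset.mul_sum, Finset.mul_sum, ← Finset.sum_add_distrib]
  rw [mem_effDom_hSum hb] at hx hy
  refine Finset.sum_le_sum fun i _ => ?_
  rw [blk_add_smul]
  exact ((hc i).convexOn_toReal (hb i)).2 (hx i) (hy i) ha hb' hab

theorem convexOn_toReal_fSum (hg : ∀ i, ConvexOn ℝ Set.univ (g i)) (hb : ∀ i y, h i y ≠ ⊥)
    (hc : ∀ i, EConvex (h i)) :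
    ConvexOn ℝ (effDom (hSum h)) fun x => (fSum g h x).toReal := by
  have hH := convexOn_hSum hb hc
  refine ⟨hH.1, fun x hx y hy a b ha hb' hab => ?_⟩
  have h₁ : ∑ i, g i (blk (a • x + b • y) i)
      ≤ a * ∑ i, g i (blk x i) + b * ∑ i, g i (blk y i) := by
    rw [Finset.mul_sum, Finset.mul_sum, ← Finset.sum_add_distrib]
    refine Finset.sum_le_sum fun i _ => ?_
    rw [blk_add_smul]
    exact (hg i).2 trivial trivial ha hb' hab
  have h₂ := hH.2 hx hy ha hb' hab
  simp only [smul_eq_mul] at h₂ ⊢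
  rw [toReal_fSum hb (hH.1 hx hy ha hb' hab), toReal_fSum hb hx, toReal_fSum hb hy]
  linarith

theorem copies_mem_effDom (hb : ∀ i y, h i y ≠ ⊥) {y : EuclideanSpace ℝ (Fin M)}
    (hy : y ∈ optSet g h) : copies V y ∈ effDom (hSum h) := by
  rw [mem_effDom_hSum hb]
  intro i
  have h₁ : ∀ i, (g i y : EReal) + h i y ≠ ⊥ := fun i => by
    simp [EReal.add_eq_bot_iff, hb]
  have := (ereal_sum_lt_top_iff h₁).1 hy.1 i (Finset.mem_univ i)
  exact ((EReal.add_ne_top_iff_ne_top₂ (EReal.coe_ne_bot _) (hb i y)).1 this.ne).2.lt_top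

end Objective

/-! ### First-order bounds for smooth convex functions. -/

section Smooth

variable {E : Type*} [NormedAddCommGroup E] [InnerProductSpace ℝ E] [CompleteSpace E]

theorem hasDerivAt_comp_line {g : E → ℝ} (hg : Differentiable ℝ g) (y d : E) (t : ℝ) :
    HasDerivAt (fun t : ℝ => g (y + t • d)) (inner ℝ (gradient g (y + t • d)) d) t := by
  have h₁ : HasDerivAt (fun t : ℝ => y + t • d) d t := by
    simpa using ((hasDerivAt_id t).smul_const d).const_add y
  have h₂ := (hg (y + t • d)).hasGradientAt.hasFDerivAt.comp_hasDerivAt t h₁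
  rwa [InnerProductSpace.toDual_apply_apply] at h₂

/-- The first-order lower bound of a differentiable convex function. -/
theorem inner_gradient_le_sub {g : E → ℝ} (hg : Differentiable ℝ g)
    (hc : ConvexOn ℝ Set.univ g) (y v : E) : inner ℝ (gradient g y) (v - y) ≤ g v - g y := by
  have hline : ConvexOn ℝ Set.univ (fun t : ℝ => g (y + t • (v - y))) := by
    refine ⟨convex_univ, fun s _ t _ a b ha hb hab => ?_⟩
    have := hc.2 (Set.mem_univ (y + s • (v - y))) (Set.mem_univ (y + t • (v - y))) ha hb hab
    convert this using 2
    obtain rfl : b = 1 - a := by linarith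
    simp only [smul_eq_mul]
    module
  have h₀ := hasDerivAt_comp_line hg y (v - y) 0
  have := hline.le_slope_of_hasDerivAt (Set.mem_univ 0) (Set.mem_univ 1) one_pos h₀
  simpa [slope_def_field] using this

/-- The quadratic upper bound of a function whose gradient is Lipschitz on a convex set. -/
theorem le_add_inner_gradient_add_sq {g : E → ℝ} (hg : Differentiable ℝ g) {D : Set E}
    (hD : Convex ℝ D) {L : ℝ}
    (hL : ∀ y ∈ D, ∀ v ∈ D, ‖gradient g y - gradient g v‖ ≤ L * ‖y - v‖)
    {y v : E} (hy : y ∈ D) (hv : v ∈ D) :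
    g v ≤ g y + inner ℝ (gradient g y) (v - y) + L / 2 * ‖v - y‖ ^ 2 := by
  set d := v - y with hd
  -- Restriction to the segment, minus its linear part and the quadratic of curvature L; the claim
  -- is ψ 1 ≤ ψ 0.
  let ψ : ℝ → ℝ := fun t => g (y + t • d) - t * inner ℝ (gradient g y) d - L / 2 * ‖d‖ ^ 2 * t ^ 2
  have hψ : ∀ t : ℝ, HasDerivAt ψ (inner ℝ (gradient g (y + t • d)) d
      - inner ℝ (gradient g y) d - L / 2 * ‖d‖ ^ 2 * (2 * t)) t := by
    intro t
    have h₁ := hasDerivAt_comp_line hg y d t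
    have h₂ := (hasDerivAt_id t).mul_const (inner ℝ (gradient g y) d)
    have h₃ := (hasDerivAt_pow 2 t).const_mul (L / 2 * ‖d‖ ^ 2)
    have h₄ := (h₁.sub h₂).sub h₃
    rwa [one_mul, Nat.cast_two, pow_one] at h₄
  have hanti : AntitoneOn ψ (Set.Icc 0 1) := by
    refine antitoneOn_of_deriv_nonpos (convex_Icc 0 1)
      (fun t _ => (hψ t).continuousAt.continuousWithinAt)
      (fun t _ => (hψ t).differentiableAt.differentiableWithinAt) fun t ht => ?_
    rw [interior_Icc] at ht
    rw [(hψ t).deriv, ← inner_sub_left]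
    -- The gradient is Lipschitz only on `D`; convexity keeps the segment inside it.
    have hmem : y + t • d ∈ D := hD.add_smul_sub_mem hy hv ⟨ht.1.le, ht.2.le⟩
    have h₁ := hL _ hmem _ hy
    rw [add_sub_cancel_left, norm_smul, Real.norm_of_nonneg ht.1.le] at h₁
    have h₂ := (real_inner_le_norm (gradient g (y + t • d) - gradient g y) d).trans
      (mul_le_mul_of_nonneg_right h₁ (norm_nonneg d))
    nlinarith
  have := hanti (Set.left_mem_Icc.2 zero_le_one) (Set.right_mem_Icc.2 zero_le_one) zero_le_one
  simp only [ψ, one_smul, zero_smul, hd, add_sub_cancel, add_zero] at this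
  simp only [one_mul, zero_mul, sub_zero, one_pow, mul_one, ne_eq, OfNat.ofNat_ne_zero,
    not_false_eq_true, zero_pow, mul_zero] at this
  linarith

end Smooth

/-! ### First-order optimality for convex plus quadratic. -/

section Minimizers

/-- A minimizer of the sum of a convex function and a quadratic satisfies the first-order
condition. -/
theorem le_add_slope_of_isMin {E : Type*} [AddCommGroup E] [Module ℝ E] {D : Set E} {H q : E → ℝ}
    (hH : ConvexOn ℝ D H) {p y : E} (hp : p ∈ D) (hy : y ∈ D)
    (hmin : ∀ v ∈ D, H p + q p ≤ H v + q v) {s c : ℝ}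
    (hq : ∀ t : ℝ, q (p + t • (y - p)) = q p + t * s + t ^ 2 * c) : H p ≤ H y + s := by
  -- Minimality against the point at parameter t, combined with convexity of `H` and divided by t.
  -- The sign of c is irrelevant, as t * c vanishes in the limit.
  have key : ∀ t : ℝ, 0 < t → t ≤ 1 → H p - H y - s ≤ t * c := by
    intro t ht ht1
    have h₁ : p + t • (y - p) = (1 - t) • p + t • y := by module
    have h₂ := hH.2 hp hy (sub_nonneg.2 ht1) ht.le (by ring)
    have h₃ := hmin _ (hH.1 hp hy (sub_nonneg.2 ht1) ht.le (by ring))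
    rw [← h₁] at h₂ h₃
    rw [hq] at h₃
    simp only [smul_eq_mul] at h₂
    have : t * (H p - H y - s) ≤ t * (t * c) := by nlinarith
    exact le_of_mul_le_mul_left this ht
  have hlim : Filter.Tendsto (fun t : ℝ => t * c) (nhdsWithin 0 (Set.Ioi 0)) (nhds 0) := by
    have : Filter.Tendsto (fun t : ℝ => t * c) (nhds 0) (nhds (0 * c)) :=
      (continuous_id.mul continuous_const).tendsto 0
    rw [zero_mul] at this
    exact this.mono_left nhdsWithin_le_nhds
  have := ge_of_tendsto hlim (b := H p - H y - s) (by
    filter_upwards [Ioc_mem_nhdsGT (zero_lt_one (α := ℝ))] with t ht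
    exact key t ht.1 ht.2)
  linarith

end Minimizers

/-! ### Blockwise norms and the smooth part of one step. -/

section Blocks

variable {V : Type*} [Fintype V] {M : ℕ}

theorem norm_blk_sub_sq {I J : Type*} (a : I × Fin M → ℝ) (b : J × Fin M → ℝ) (i : I) (j : J) :
    ‖blk a i - blk b j‖ ^ 2 = ∑ k, (a (i, k) - b (j, k)) ^ 2 := by
  simp [EuclideanSpace.real_norm_sq_eq, blk]

theorem l2norm_sq {I : Type*} [Fintype I] (v : I → ℝ) : l2norm v ^ 2 = ∑ i, v i ^ 2 := by
  simp [l2norm, EuclideanSpace.real_norm_sq_eq]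

theorem l2norm_nonneg {I : Type*} [Fintype I] (v : I → ℝ) : 0 ≤ l2norm v := norm_nonneg _

/-- The increment of the smooth part of the objective over one proximal-gradient step. -/
theorem sum_smooth_le {g : V → EuclideanSpace ℝ (Fin M) → ℝ}
    {h : V → EuclideanSpace ℝ (Fin M) → EReal}
    (hg_convex : ∀ i, ConvexOn ℝ Set.univ (g i)) (hg_diff : ∀ i, Differentiable ℝ (g i))
    (hb : ∀ i y, h i y ≠ ⊥) (hc : ∀ i, EConvex (h i)) {P : V → ℝ}
    (hg_lip : ∀ i, ∀ y ∈ effDom (h i), ∀ v ∈ effDom (h i),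
      ‖gradient (g i) y - gradient (g i) v‖ ≤ P i * ‖y - v‖)
    {x x' : V × Fin M → ℝ} (y : V × Fin M → ℝ) (hx : x ∈ effDom (hSum h))
    (hx' : x' ∈ effDom (hSum h)) :
    ∑ i, g i (blk x' i) ≤ ∑ i, g i (blk y i) + ∑ p, gradVec g x p * (x' p - y p)
      + 1 / 2 * ∑ p : V × Fin M, P p.1 * (x' p - x p) ^ 2 := by
  rw [mem_effDom_hSum hb] at hx hx'
  rw [Fintype.sum_prod_type, Fintype.sum_prod_type, Finset.mul_sum, ← Finset.sum_add_distrib,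
    ← Finset.sum_add_distrib]
  refine Finset.sum_le_sum fun i _ => ?_
  -- Descent from x to x', then the tangent at x as a lower bound at y; eliminating g_i(x) gives the
  -- claim.
  have h₁ := le_add_inner_gradient_add_sq (hg_diff i) ((hc i).convexOn_toReal (hb i)).1 (hg_lip i)
    (hx i) (hx' i)
  have h₂ := inner_gradient_le_sub (hg_diff i) (hg_convex i) (blk x i) (blk y i)
  rw [norm_blk_sub_sq] at h₁
  have h₃ : ∀ a : V × Fin M → ℝ, inner ℝ (gradient (g i) (blk x i)) (blk a i - blk x i)
      = ∑ k, gradVec g x (i, k) * (a (i, k) - x (i, k)) := fun a => by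
    simp only [PiLp.inner_apply, gradVec, blk, PiLp.sub_apply]
    exact Finset.sum_congr rfl fun k _ => by simp [mul_comm]
  rw [h₃] at h₁ h₂
  have h₄ : ∑ k, gradVec g x (i, k) * (x' (i, k) - y (i, k))
      = ∑ k, gradVec g x (i, k) * (x' (i, k) - x (i, k))
        - ∑ k, gradVec g x (i, k) * (y (i, k) - x (i, k)) := by
    rw [← Finset.sum_sub_distrib]
    exact Finset.sum_congr rfl fun k _ => by ring
  simp only
  rw [h₄, ← Finset.mul_sum]
  linarith

end Blocks

/-! ### Invariants and optimality conditions of a run. -/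

section Run

variable {V : Type*} [Fintype V] [DecidableEq V] {G : SimpleGraph V} [DecidableRel G.Adj] {M : ℕ}
  {h : V → EuclideanSpace ℝ (Fin M) → EReal} {pen : G.Dart → ℝ} {om : V → ℝ}

/-- The `z`-update averages the two ends of each arc. -/
theorem eq_average_of_isMinOn_zObj (hpen : ∀ e, 0 < pen e) {x : V × Fin M → ℝ}
    {l : (G.Dart × Fin M) ⊕ (G.Dart × Fin M) → ℝ} {z : G.Dart × Fin M → ℝ}
    (hl : ∀ e, l (.inl e) + l (.inr e) = 0) (hz : IsMinOn (zObj pen x l) Set.univ z)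
    (e : G.Dart × Fin M) : z e = (x (e.1.fst, e.2) + x (e.1.snd, e.2)) / 2 := by
  set c : G.Dart × Fin M → ℝ := fun e => (x (e.1.fst, e.2) + x (e.1.snd, e.2)) / 2 with hc
  -- The two halves of the multiplier are opposite, so the terms linear in z - c cancel and the
  -- objective separates as a square around the average.
  have hdec : zObj pen x l z = zObj pen x l c + ∑ e, pen e.1 * (z e - c e) ^ 2 := by
    rw [zObj_eq_sum hpen, zObj_eq_sum hpen, Finset.mul_sum, Finset.mul_sum,
      ← Finset.sum_add_distrib]
    refine Finset.sum_congr rfl fun e _ => ?_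
    rw [eq_neg_of_add_eq_zero_right (hl e)]
    simp only [hc]
    ring
  have hle : ∑ e, pen e.1 * (z e - c e) ^ 2 ≤ 0 := by
    have := hz (Set.mem_univ c)
    simp only [Set.mem_ofPred_eq] at this
    linarith
  have hnn : ∀ e ∈ Finset.univ, 0 ≤ pen e.1 * (z e - c e) ^ 2 := fun e _ =>
    mul_nonneg (hpen e.1).le (sq_nonneg _)
  have h0 := (Finset.sum_eq_zero_iff_of_nonneg hnn).1 (le_antisymm hle (Finset.sum_nonneg hnn)) e
    (Finset.mem_univ e)
  have := pow_eq_zero_iff (two_ne_zero) |>.1 ((mul_eq_zero.1 h0).resolve_left (hpen e.1).ne')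
  exact sub_eq_zero.1 this

variable {Ω : Type*} {S : V → Type*}
  {gt : ∀ i, EuclideanSpace ℝ (Fin M) → S i → EuclideanSpace ℝ (Fin M)}
  {eta : ℕ → ℝ} {xi : ℕ → Ω → ∀ i, S i}
  {x0 : V × Fin M → ℝ} {z0 : G.Dart × Fin M → ℝ} {l0 : (G.Dart × Fin M) ⊕ (G.Dart × Fin M) → ℝ}
  {x : ℕ → Ω → V × Fin M → ℝ} {z : ℕ → Ω → G.Dart × Fin M → ℝ}
  {l : ℕ → Ω → (G.Dart × Fin M) ⊕ (G.Dart × Fin M) → ℝ}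

theorem IsRun.l_step_inl (hrun : IsRun h gt pen om eta xi x0 z0 l0 x z l) (r : ℕ) (w : Ω)
    (e : G.Dart × Fin M) : l (r + 1) w (.inl e)
      = l r w (.inl e) + pen e.1 * (x (r + 1) w (e.1.fst, e.2) - z (r + 1) w e) := by
  rw [hrun.l_step, Gam_eq_diagonal]
  simp [Matrix.mulVec_diagonal, A_mulVec_inl, B_mulVec_inl, sub_eq_add_neg]

theorem IsRun.l_step_inr (hrun : IsRun h gt pen om eta xi x0 z0 l0 x z l) (r : ℕ) (w : Ω)
    (e : G.Dart × Fin M) : l (r + 1) w (.inr e)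
      = l r w (.inr e) + pen e.1 * (x (r + 1) w (e.1.snd, e.2) - z (r + 1) w e) := by
  rw [hrun.l_step, Gam_eq_diagonal]
  simp [Matrix.mulVec_diagonal, A_mulVec_inr, B_mulVec_inr, sub_eq_add_neg]

/-- Invariance of Bᵀλ = 0: once z is the average, the residuals at the two ends of an arc are
opposite. The induction hypothesis is itself what makes the next z the average. -/
theorem IsRun.dual_balanced (hpen : ∀ e, 0 < pen e)
    (hrun : IsRun h gt pen om eta xi x0 z0 l0 x z l) (r : ℕ) (w : Ω) (e : G.Dart × Fin M) :
    l r w (.inl e) + l r w (.inr e) = 0 := by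
  induction r generalizing e with
  | zero =>
    have := congrFun hrun.init_dual e
    rw [B_transpose_mulVec, Pi.zero_apply, neg_eq_zero] at this
    rw [hrun.l_zero, this]
  | succ r ih =>
    rw [hrun.l_step_inl, hrun.l_step_inr, eq_average_of_isMinOn_zObj hpen ih (hrun.z_step r w) e]
    linear_combination ih e

theorem IsRun.z_eq_average (hpen : ∀ e, 0 < pen e)
    (hrun : IsRun h gt pen om eta xi x0 z0 l0 x z l) (r : ℕ) (w : Ω) (e : G.Dart × Fin M) :
    z r w e = (x r w (e.1.fst, e.2) + x r w (e.1.snd, e.2)) / 2 := by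
  cases r with
  | zero =>
    rw [hrun.z_zero, hrun.x_zero, hrun.init_link, Pi.smul_apply, Mplus_transpose_mulVec,
      smul_eq_mul]
    ring
  | succ r =>
    exact eq_average_of_isMinOn_zObj hpen (hrun.dual_balanced hpen r w) (hrun.z_step r w) e

theorem IsRun.mem_dom (hpen : ∀ e, 0 < pen e) (hx0 : x0 ∈ effDom (hSum h))
    (hrun : IsRun h gt pen om eta xi x0 z0 l0 x z l) (r : ℕ) (w : Ω) :
    x r w ∈ effDom (hSum h) := by
  cases r with
  | zero => rwa [hrun.x_zero]
  | succ r =>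
    -- A minimizer does at least as well as `x0`, where the objective is finite.
    have := hrun.x_step r w (Set.mem_univ x0)
    simp only [Set.mem_ofPred_eq, xObj_eq_xQuad hpen] at this
    have h₂ := this.trans_lt (EReal.add_lt_top hx0.ne (EReal.coe_ne_top _))
    by_contra hcon
    rw [effDom, Set.mem_ofPred_eq, not_lt, top_le_iff] at hcon
    rw [hcon, EReal.top_add_coe] at h₂
    exact lt_irrefl _ h₂

/-- The `x`-update minimizes the real-valued objective over the domain of `h`. -/
theorem IsRun.x_step_real (hpen : ∀ e, 0 < pen e) (hb : ∀ i y, h i y ≠ ⊥)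
    (hx0 : x0 ∈ effDom (hSum h)) (hrun : IsRun h gt pen om eta xi x0 z0 l0 x z l) (r : ℕ) (w : Ω)
    {v : V × Fin M → ℝ} (hv : v ∈ effDom (hSum h)) :
    (hSum h (x (r + 1) w)).toReal
        + xQuad pen om (eta (r + 1)) (stochGrad gt (x r w) (xi (r + 1) w)) (x r w) (z r w) (l r w)
          (x (r + 1) w)
      ≤ (hSum h v).toReal
        + xQuad pen om (eta (r + 1)) (stochGrad gt (x r w) (xi (r + 1) w)) (x r w) (z r w) (l r w)
          v := by
  have := hrun.x_step r w (Set.mem_univ v)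
  simp only [Set.mem_ofPred_eq, xObj_eq_xQuad hpen] at this
  rw [← EReal.coe_toReal hv.ne (hSum_ne_bot hb v),
    ← EReal.coe_toReal (hrun.mem_dom hpen hx0 (r + 1) w).ne (hSum_ne_bot hb _)] at this
  exact_mod_cast this

/-- First-order optimality of the `x`-update. -/
theorem IsRun.x_step_optimality (hpen : ∀ e, 0 < pen e) (hb : ∀ i y, h i y ≠ ⊥)
    (hc : ∀ i, EConvex (h i)) (hx0 : x0 ∈ effDom (hSum h))
    (hrun : IsRun h gt pen om eta xi x0 z0 l0 x z l) (r : ℕ) (w : Ω)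
    {v : V × Fin M → ℝ} (hv : v ∈ effDom (hSum h)) :
    (hSum h (x (r + 1) w)).toReal ≤ (hSum h v).toReal
      + xSlope pen om (eta (r + 1)) (stochGrad gt (x r w) (xi (r + 1) w)) (x r w) (z r w) (l r w)
        (x (r + 1) w) (v - x (r + 1) w) :=
  le_add_slope_of_isMin (convexOn_hSum hb hc) (hrun.mem_dom hpen hx0 (r + 1) w) hv
    (fun _ hu => hrun.x_step_real hpen hb hx0 r w hu)
    (fun t => xQuad_add_smul hpen om _ _ _ _ _ _ _ t)

/-- The step-size condition, evaluated at a vector. -/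
theorem two_mul_sum_le_of_posDef {P : V → ℝ}
    (hstep : ((2 : ℝ) • nodeDiag M om + Mplus G M * XiI M pen * (Mplus G M)ᵀ
      - (2 : ℝ) • nodeDiag M P).PosDef) (v : V × Fin M → ℝ) :
    2 * ∑ p, P p.1 * v p ^ 2 ≤ 2 * ∑ p, om p.1 * v p ^ 2
      + ∑ e : G.Dart × Fin M, pen e.1 * (v (e.1.fst, e.2) + v (e.1.snd, e.2)) ^ 2 := by
  have h₁ := hstep.posSemidef.dotProduct_mulVec_nonneg v
  have h₂ : v ⬝ᵥ ((Mplus G M * XiI M pen * (Mplus G M)ᵀ) *ᵥ v)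
      = ∑ e : G.Dart × Fin M, pen e.1 * (v (e.1.fst, e.2) + v (e.1.snd, e.2)) ^ 2 := by
    rw [← Matrix.mulVec_mulVec, ← Matrix.mulVec_mulVec, Matrix.dotProduct_mulVec,
      ← Matrix.mulVec_transpose, XiI_eq_diagonal]
    simp only [dotProduct, Matrix.mulVec_diagonal, Mplus_transpose_mulVec]
    exact Finset.sum_congr rfl fun e _ => by ring
  have h₃ : ∀ c : V → ℝ, v ⬝ᵥ (nodeDiag M c *ᵥ v) = ∑ p, c p.1 * v p ^ 2 := fun c => by
    rw [nodeDiag_eq_diagonal]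
    exact wsq_diagonal _ v
  rw [star_trivial, Matrix.sub_mulVec, Matrix.add_mulVec, Matrix.smul_mulVec, Matrix.smul_mulVec,
    dotProduct_sub, dotProduct_add, dotProduct_smul, dotProduct_smul, h₂, h₃, h₃, smul_eq_mul,
    smul_eq_mul] at h₁
  linarith

end Run

/-! ### The one-step estimate. -/

section Step

variable {V : Type*} [Fintype V] [DecidableEq V] {G : SimpleGraph V} [DecidableRel G.Adj] {M : ℕ}
  {g : V → EuclideanSpace ℝ (Fin M) → ℝ}
  {h : V → EuclideanSpace ℝ (Fin M) → EReal} {pen : G.Dart → ℝ} {om : V → ℝ}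
  {Ω : Type*} {S : V → Type*}
  {gt : ∀ i, EuclideanSpace ℝ (Fin M) → S i → EuclideanSpace ℝ (Fin M)}
  {eta : ℕ → ℝ} {xi : ℕ → Ω → ∀ i, S i}
  {x0 : V × Fin M → ℝ} {z0 : G.Dart × Fin M → ℝ} {l0 : (G.Dart × Fin M) ⊕ (G.Dart × Fin M) → ℝ}
  {x : ℕ → Ω → V × Fin M → ℝ} {z : ℕ → Ω → G.Dart × Fin M → ℝ}
  {l : ℕ → Ω → (G.Dart × Fin M) ⊕ (G.Dart × Fin M) → ℝ}

/-- The part of the descent estimate that is a sum over the arcs. -/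
theorem sum_arc_le (hpen : ∀ e, 0 < pen e) {x x' : V × Fin M → ℝ} {z z' : G.Dart × Fin M → ℝ}
    {l l' : (G.Dart × Fin M) ⊕ (G.Dart × Fin M) → ℝ} (y : EuclideanSpace ℝ (Fin M))
    (lam : (G.Dart × Fin M) ⊕ (G.Dart × Fin M) → ℝ)
    (hz : ∀ e, z e = (x (e.1.fst, e.2) + x (e.1.snd, e.2)) / 2)
    (hz' : ∀ e, z' e = (x' (e.1.fst, e.2) + x' (e.1.snd, e.2)) / 2)
    (hl : ∀ e, l (.inl e) + l (.inr e) = 0)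
    (hl₁ : ∀ e, l' (.inl e) = l (.inl e) + pen e.1 * (x' (e.1.fst, e.2) - z' e))
    (hl₂ : ∀ e, l' (.inr e) = l (.inr e) + pen e.1 * (x' (e.1.snd, e.2) - z' e)) :
    ∑ e : G.Dart × Fin M,
        ((pen e.1 * (x' (e.1.fst, e.2) - z e) + l (.inl e)) * (y e.2 - x' (e.1.fst, e.2))
          + (pen e.1 * (x' (e.1.snd, e.2) - z e) + l (.inr e)) * (y e.2 - x' (e.1.snd, e.2)))
      + lam ⬝ᵥ (A G M *ᵥ x' + B G M *ᵥ z')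
      + 1 / 4 * ∑ e : G.Dart × Fin M, pen e.1 *
        ((x' (e.1.fst, e.2) - x (e.1.fst, e.2)) + (x' (e.1.snd, e.2) - x (e.1.snd, e.2))) ^ 2
    ≤ 1 / 2 * (wsq (Gam M pen)⁻¹ (lam - l) - wsq (Gam M pen)⁻¹ (lam - l'))
      + (∑ e, pen e.1 * (z e - y e.2) ^ 2 - ∑ e, pen e.1 * (z' e - y e.2) ^ 2) := by
  rw [wsq_inv_Gam hpen, wsq_inv_Gam hpen, dotProduct, Fintype.sum_sum_type]
  simp only [Pi.add_apply, Pi.sub_apply, A_mulVec_inl, A_mulVec_inr, B_mulVec_inl, B_mulVec_inr]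
  rw [← Finset.sum_sub_distrib, ← Finset.sum_sub_distrib, Finset.mul_sum, Finset.mul_sum,
    ← Finset.sum_add_distrib, ← Finset.sum_add_distrib, ← Finset.sum_add_distrib,
    ← Finset.sum_add_distrib]
  refine Finset.sum_le_sum fun e _ => ?_
  have hp := hpen e.1
  have h₂ : l (.inr e) = - l (.inl e) := eq_neg_of_add_eq_zero_right (hl e)
  rw [hl₁, hl₂, hz', hz, h₂]
  generalize x' (e.1.fst, e.2) = a
  generalize x' (e.1.snd, e.2) = b
  generalize x (e.1.fst, e.2) = a'
  generalize x (e.1.snd, e.2) = b'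
  generalize l (.inl e) = m
  generalize lam (.inl e) = p
  generalize lam (.inr e) = q
  generalize y e.2 = t
  generalize pen e.1 = c at hp
  -- Change of the Γ⁻¹-distance under the multiplier step m ↦ m + c * v, with u the old difference.
  have key : ∀ u v : ℝ, c⁻¹ * (u ^ 2 - (u - c * v) ^ 2) = 2 * u * v - c * v ^ 2 := fun u v => by
    field_simp; ring
  have k₁ := key (p - m) (a - (a + b) / 2)
  have k₂ := key (q + m) (b - (a + b) / 2)
  -- The slack of the inequality is a quarter of this term: the penalty yields twice the squared
  -- half-difference of the ends, and the multiplier step uses it once.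
  have h₃ : 0 ≤ c * (a - b) ^ 2 := by positivity
  have e₁ : c⁻¹ * ((p - m) ^ 2 + (q - -m) ^ 2)
        - c⁻¹ * ((p - (m + c * (a - (a + b) / 2))) ^ 2 + (q - (-m + c * (b - (a + b) / 2))) ^ 2)
      = (2 * (p - m) * (a - (a + b) / 2) - c * (a - (a + b) / 2) ^ 2)
        + (2 * (q + m) * (b - (a + b) / 2) - c * (b - (a + b) / 2) ^ 2) := by
    rw [← k₁, ← k₂]; ring
  rw [e₁]
  nlinarith

/-- The part of the descent estimate that is a sum over the agents. -/
theorem sum_node_le {eta : ℝ} (heta : 0 < eta) (u v x x' y : V × Fin M → ℝ) :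
    ∑ p, v p * (y p - x' p) + ∑ p, u p * (x' p - y p)
      + ∑ p : V × Fin M, (om p.1 + eta) * (x' p - x p) * (y p - x' p)
      + 1 / 2 * ∑ p : V × Fin M, om p.1 * (x' p - x p) ^ 2
    ≤ (u - v) ⬝ᵥ (x - y) + 1 / (2 * eta) * l2norm (v - u) ^ 2
      + 1 / 2 * (∑ p : V × Fin M, om p.1 * (x p - y p) ^ 2 - ∑ p, om p.1 * (x' p - y p) ^ 2)
      + eta / 2 * (l2norm (x - y) ^ 2 - l2norm (x' - y) ^ 2) := by
  simp only [l2norm_sq, dotProduct, Pi.sub_apply]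
  rw [← Finset.sum_sub_distrib, ← Finset.sum_sub_distrib]
  simp only [Finset.mul_sum]
  rw [← Finset.sum_add_distrib, ← Finset.sum_add_distrib, ← Finset.sum_add_distrib,
    ← Finset.sum_add_distrib, ← Finset.sum_add_distrib, ← Finset.sum_add_distrib]
  refine Finset.sum_le_sum fun p _ => ?_
  -- Young's inequality with weight `eta`: its quadratic term is exactly what the three-point
  -- identity for the `eta`-proximal term supplies.
  have h₁ : (u p - v p) * (x' p - x p)
      ≤ 1 / (2 * eta) * (v p - u p) ^ 2 + eta / 2 * (x' p - x p) ^ 2 := by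
    have : 1 / (2 * eta) * (v p - u p) ^ 2 + eta / 2 * (x' p - x p) ^ 2
        - (u p - v p) * (x' p - x p)
        = 1 / (2 * eta) * ((v p - u p) + eta * (x' p - x p)) ^ 2 := by
      field_simp; ring
    have h₂ : 0 ≤ 1 / (2 * eta) * ((v p - u p) + eta * (x' p - x p)) ^ 2 := by positivity
    linarith
  nlinarith

/-- The basic estimate for one step of the algorithm. -/
theorem IsRun.step_estimate (hg_convex : ∀ i, ConvexOn ℝ Set.univ (g i))
    (hg_diff : ∀ i, Differentiable ℝ (g i)) (hb : ∀ i y, h i y ≠ ⊥) (hc : ∀ i, EConvex (h i))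
    {P : V → ℝ}
    (hg_lip : ∀ i, ∀ y ∈ effDom (h i), ∀ v ∈ effDom (h i),
      ‖gradient (g i) y - gradient (g i) v‖ ≤ P i * ‖y - v‖)
    {ystar : EuclideanSpace ℝ (Fin M)} (hy : copies V ystar ∈ effDom (hSum h))
    (hpen : ∀ e, 0 < pen e)
    (hstep : ((2 : ℝ) • nodeDiag M om + Mplus G M * XiI M pen * (Mplus G M)ᵀ
      - (2 : ℝ) • nodeDiag M P).PosDef)
    (hx0 : x0 ∈ effDom (hSum h)) (hrun : IsRun h gt pen om eta xi x0 z0 l0 x z l)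
    (r : ℕ) (heta : 0 < eta (r + 1)) (w : Ω)
    (lam : (G.Dart × Fin M) ⊕ (G.Dart × Fin M) → ℝ) :
    (fSum g h (x (r + 1) w)).toReal - (fSum g h (copies V ystar)).toReal
      + lam ⬝ᵥ (A G M *ᵥ x (r + 1) w + B G M *ᵥ z (r + 1) w)
    ≤ (gradVec g (x r w) - stochGrad gt (x r w) (xi (r + 1) w)) ⬝ᵥ (x r w - copies V ystar)
      + 1 / (2 * eta (r + 1)) *
        l2norm (stochGrad gt (x r w) (xi (r + 1) w) - gradVec g (x r w)) ^ 2
      + 1 / 2 * (wsq (Gam M pen)⁻¹ (lam - l r w) - wsq (Gam M pen)⁻¹ (lam - l (r + 1) w))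
      + (∑ e : G.Dart × Fin M, pen e.1 * (z r w e - ystar e.2) ^ 2
        - ∑ e : G.Dart × Fin M, pen e.1 * (z (r + 1) w e - ystar e.2) ^ 2)
      + 1 / 2 * (∑ p : V × Fin M, om p.1 * (x r w p - copies V ystar p) ^ 2
        - ∑ p, om p.1 * (x (r + 1) w p - copies V ystar p) ^ 2)
      + eta (r + 1) / 2 * (l2norm (x r w - copies V ystar) ^ 2
        - l2norm (x (r + 1) w - copies V ystar) ^ 2) := by
  have hx := hrun.mem_dom hpen hx0 r w
  have hx' := hrun.mem_dom hpen hx0 (r + 1) w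
  have h₁ := hrun.x_step_optimality hpen hb hc hx0 r w hy
  have h₂ := sum_smooth_le hg_convex hg_diff hb hc hg_lip (copies V ystar) hx hx'
  have h₃ := sum_arc_le hpen ystar lam (hrun.z_eq_average hpen r w)
    (hrun.z_eq_average hpen (r + 1) w) (hrun.dual_balanced hpen r w) (hrun.l_step_inl r w)
    (hrun.l_step_inr r w)
  have h₄ := sum_node_le (om := om) heta (gradVec g (x r w))
    (stochGrad gt (x r w) (xi (r + 1) w)) (x r w) (x (r + 1) w) (copies V ystar)
  -- A quarter of this inequality pays the curvature term of `h₂` with the increments kept on the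
  -- left in `h₃` and `h₄`.
  have h₅ := two_mul_sum_le_of_posDef hstep (x (r + 1) w - x r w)
  rw [toReal_fSum hb hx', toReal_fSum hb hy]
  simp only [xSlope, Pi.sub_apply] at h₁ h₅
  simp only [copies] at h₁ h₂ h₃ h₄ ⊢
  linarith

end Step

/-! ### Sums with square-root weights. -/

section Telescoping

/-- Summation by parts: the weights increase and D - a t is nonnegative. The term in `a r` is
retained to make the induction close. -/
theorem sum_sqrt_mul_sub_le {a : ℕ → ℝ} {D : ℝ} (ha : ∀ t, a t ≤ D) (r : ℕ) :
    ∑ t ∈ Finset.range r, Real.sqrt ((t : ℝ) + 1) * (a t - a (t + 1))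
      ≤ Real.sqrt r * (D - a r) := by
  induction r with
  | zero => simp
  | succ r ih =>
    rw [Finset.sum_range_succ]
    push_cast
    have h₁ : Real.sqrt r ≤ Real.sqrt ((r : ℝ) + 1) := Real.sqrt_le_sqrt (by linarith)
    nlinarith [mul_le_mul_of_nonneg_right h₁ (sub_nonneg.2 (ha r))]

/-- Each term is at most √(t+1) - √t, which telescopes. -/
theorem sum_inv_sqrt_le (r : ℕ) :
    ∑ t ∈ Finset.range r, 1 / (2 * Real.sqrt ((t : ℝ) + 1)) ≤ Real.sqrt r := by
  induction r with
  | zero => simp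
  | succ r ih =>
    rw [Finset.sum_range_succ]
    push_cast
    have hs : 0 < Real.sqrt ((r : ℝ) + 1) := Real.sqrt_pos.2 (by positivity)
    have h₁ : Real.sqrt ((r : ℝ) + 1) ^ 2 = r + 1 := Real.sq_sqrt (by positivity)
    have h₂ : Real.sqrt (r : ℝ) ^ 2 = r := Real.sq_sqrt (by positivity)
    have h₃ : 1 / (2 * Real.sqrt ((r : ℝ) + 1)) ≤ Real.sqrt ((r : ℝ) + 1) - Real.sqrt r := by
      rw [div_le_iff₀ (by positivity)]
      nlinarith [sq_nonneg (Real.sqrt ((r : ℝ) + 1) - Real.sqrt r)]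
    linarith

end Telescoping

theorem avg_eq_sum_range {Ω I : Type*} (u : ℕ → Ω → I → ℝ) (r : ℕ) (w : Ω) :
    avg u r w = ∑ t ∈ Finset.range r, (1 / (r : ℝ)) • u (t + 1) w := by
  rw [avg, Finset.smul_sum, Finset.range_eq_Ico, Finset.sum_Ico_add' (fun t => (1 / (r : ℝ)) • u t w)]
  rfl

/-- The norm as a support function: u is v rescaled to length rho. When v = 0 the inverse is 0, so u
= 0 still works. -/
theorem exists_dotProduct_eq_mul_l2norm {I : Type*} [Fintype I] (v : I → ℝ) {rho : ℝ}
    (hrho : 0 ≤ rho) : ∃ u : I → ℝ, l2norm u ≤ rho ∧ u ⬝ᵥ v = rho * l2norm v := by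
  have hvv : v ⬝ᵥ v = l2norm v ^ 2 := by
    rw [l2norm_sq]
    exact Finset.sum_congr rfl fun i _ => (sq (v i)).symm
  refine ⟨(rho * (l2norm v)⁻¹) • v, ?_, ?_⟩
  · rw [l2norm, WithLp.toLp_smul, norm_smul, Real.norm_of_nonneg
      (mul_nonneg hrho (inv_nonneg.2 (l2norm_nonneg v))), mul_assoc]
    exact mul_le_of_le_one_right hrho (inv_mul_le_one (a := l2norm v))
  · rw [smul_dotProduct, hvv, smul_eq_mul]
    rcases eq_or_ne (l2norm v) 0 with h0 | h0
    · simp [h0]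
    · field_simp

/-! ### Distances controlled by the suprema in the bound. -/

section Constants

variable {V : Type*} [Fintype V] [DecidableEq V] {G : SimpleGraph V} [DecidableRel G.Adj] {M : ℕ}

theorem l2norm_sub_le_dX {D : Set (V × Fin M → ℝ)}
    (hD : ∃ C : ℝ, ∀ a ∈ D, ∀ b ∈ D, l2norm (a - b) ≤ C) {a b : V × Fin M → ℝ} (ha : a ∈ D)
    (hb : b ∈ D) : l2norm (a - b) ≤ dX D := by
  obtain ⟨C, hC⟩ := hD
  refine le_csSup ⟨C, ?_⟩ ⟨a, ha, b, hb, rfl⟩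
  rintro _ ⟨a, ha, b, hb, rfl⟩
  exact hC a ha b hb

theorem norm_blk_sub_le {I : Type*} [Fintype I] (a b : I × Fin M → ℝ) (i : I) :
    ‖blk a i - blk b i‖ ≤ l2norm (a - b) := by
  refine le_of_sq_le_sq ?_ (l2norm_nonneg _)
  rw [norm_blk_sub_sq, l2norm_sq, Fintype.sum_prod_type]
  exact Finset.single_le_sum (f := fun i => ∑ k, (a - b) (i, k) ^ 2)
    (fun i _ => Finset.sum_nonneg fun k _ => sq_nonneg _) (Finset.mem_univ i)

/-- A real `sSup` dominates its set only if the set is bounded above. Blocks of different agents are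
compared through the common value y, hence the constant C + C. -/
theorem sum_le_dZ_sq {pen : G.Dart → ℝ} (hpen : ∀ e, 0 < pen e) {D : Set (V × Fin M → ℝ)}
    (hD : ∃ C : ℝ, ∀ a ∈ D, ∀ b ∈ D, l2norm (a - b) ≤ C) {y : EuclideanSpace ℝ (Fin M)}
    (hy : copies V y ∈ D) {a b : V × Fin M → ℝ} (ha : a ∈ D) (hb : b ∈ D) :
    ∑ e : G.Dart, 2 * pen e * ‖blk a e.fst - blk b e.snd‖ ^ 2 ≤ dZ pen D ^ 2 := by
  have hnn : ∀ a b : V × Fin M → ℝ,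
      0 ≤ ∑ e : G.Dart, 2 * pen e * ‖blk a e.fst - blk b e.snd‖ ^ 2 := fun a b =>
    Finset.sum_nonneg fun e _ => by have := hpen e; positivity
  obtain ⟨C, hC⟩ := hD
  have hle : Real.sqrt (∑ e : G.Dart, 2 * pen e * ‖blk a e.fst - blk b e.snd‖ ^ 2) ≤ dZ pen D := by
    refine le_csSup ⟨Real.sqrt (∑ e : G.Dart, 2 * pen e * (C + C) ^ 2), ?_⟩ ⟨a, ha, b, hb, rfl⟩
    rintro _ ⟨a, ha, b, hb, rfl⟩
    refine Real.sqrt_le_sqrt (Finset.sum_le_sum fun e _ => ?_)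
    have h₁ : ‖blk a e.fst - y‖ ≤ C := (norm_blk_sub_le a (copies V y) e.fst).trans (hC a ha _ hy)
    have h₂ : ‖y - blk b e.snd‖ ≤ C := (norm_blk_sub_le (copies V y) b e.snd).trans (hC _ hy b hb)
    have h₃ := norm_sub_le_norm_sub_add_norm_sub (blk a e.fst) y (blk b e.snd)
    have := hpen e
    gcongr
    linarith
  calc _ = Real.sqrt (∑ e : G.Dart, 2 * pen e * ‖blk a e.fst - blk b e.snd‖ ^ 2) ^ 2 :=
        (Real.sq_sqrt (hnn a b)).symm
    _ ≤ _ := pow_le_pow_left₀ (Real.sqrt_nonneg _) hle 2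

/-- The initial distance of the link variable from the consensus solution. -/
theorem sum_link_le_dZ_sq {pen : G.Dart → ℝ} (hpen : ∀ e, 0 < pen e) {D : Set (V × Fin M → ℝ)}
    (hD : ∃ C : ℝ, ∀ a ∈ D, ∀ b ∈ D, l2norm (a - b) ≤ C) {y : EuclideanSpace ℝ (Fin M)}
    (hy : copies V y ∈ D) {x : V × Fin M → ℝ} (hx : x ∈ D) {z : G.Dart × Fin M → ℝ}
    (hz : ∀ e, z e = (x (e.1.fst, e.2) + x (e.1.snd, e.2)) / 2) :
    ∑ e : G.Dart × Fin M, pen e.1 * (z e - y e.2) ^ 2 ≤ 1 / 2 * dZ pen D ^ 2 := by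
  have h₁ := sum_le_dZ_sq hpen hD hy hx hy
  have h₂ := sum_le_dZ_sq hpen hD hy hy hx
  -- z - y averages the deviations of the two ends, so convexity of the square applies. The first
  -- end is measured by the pair (x, y*), the second by the reversed pair, since `dZ` uses the tail
  -- of one vector and the head of the other.
  suffices hs : ∑ e : G.Dart × Fin M, pen e.1 * (z e - y e.2) ^ 2
      ≤ 1 / 4 * ∑ e : G.Dart, 2 * pen e * ‖blk x e.fst - blk (copies V y) e.snd‖ ^ 2
        + 1 / 4 * ∑ e : G.Dart, 2 * pen e * ‖blk (copies V y) e.fst - blk x e.snd‖ ^ 2 by linarith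
  simp only [norm_blk_sub_sq]
  rw [Fintype.sum_prod_type, Finset.mul_sum, Finset.mul_sum, ← Finset.sum_add_distrib]
  refine Finset.sum_le_sum fun e _ => ?_
  simp only [Finset.mul_sum]
  rw [← Finset.sum_add_distrib]
  refine Finset.sum_le_sum fun k _ => ?_
  rw [hz]
  simp only [copies]
  have := mul_nonneg (hpen e).le (sq_nonneg (x (e.fst, k) - x (e.snd, k)))
  nlinarith

theorem wsq_inv_Gam_nonneg {pen : G.Dart → ℝ} (hpen : ∀ e, 0 < pen e)
    (u : (G.Dart × Fin M) ⊕ (G.Dart × Fin M) → ℝ) : 0 ≤ wsq (Gam M pen)⁻¹ u := by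
  rw [wsq_inv_Gam hpen]
  exact Finset.sum_nonneg fun e _ => by have := hpen e.1; positivity

theorem wsq_le_dLam_sq {pen : G.Dart → ℝ} (hpen : ∀ e, 0 < pen e)
    (l0 : (G.Dart × Fin M) ⊕ (G.Dart × Fin M) → ℝ) {rho : ℝ}
    {lam : (G.Dart × Fin M) ⊕ (G.Dart × Fin M) → ℝ} (hlam : l2norm lam ≤ rho) :
    wsq (Gam M pen)⁻¹ (lam - l0) ≤ dLam pen l0 rho ^ 2 := by
  have hle : Real.sqrt (wsq (Gam M pen)⁻¹ (lam - l0)) ≤ dLam pen l0 rho := by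
    refine le_csSup ⟨Real.sqrt (∑ e : G.Dart × Fin M, (pen e.1)⁻¹ *
      ((2 * rho ^ 2 + 2 * l0 (.inl e) ^ 2) + (2 * rho ^ 2 + 2 * l0 (.inr e) ^ 2))), ?_⟩
      ⟨lam, hlam, rfl⟩
    rintro _ ⟨u, hu, rfl⟩
    rw [wsq_inv_Gam hpen]
    refine Real.sqrt_le_sqrt (Finset.sum_le_sum fun e _ => ?_)
    -- A crude coordinatewise bound on the ball, used only to show that the supremum is finite.
    have h₁ : ∀ i, (u - l0) i ^ 2 ≤ 2 * rho ^ 2 + 2 * l0 i ^ 2 := fun i => by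
      have h₂ : u i ^ 2 ≤ rho ^ 2 := by
        refine le_trans ?_ (pow_le_pow_left₀ (l2norm_nonneg u) hu 2)
        rw [l2norm_sq]
        exact Finset.single_le_sum (f := fun i => u i ^ 2) (fun i _ => sq_nonneg _)
          (Finset.mem_univ i)
      rw [Pi.sub_apply]
      nlinarith [sq_nonneg (u i + l0 i)]
    exact mul_le_mul_of_nonneg_left (add_le_add (h₁ _) (h₁ _)) (inv_nonneg.2 (hpen e.1).le)
  calc _ = Real.sqrt (wsq (Gam M pen)⁻¹ (lam - l0)) ^ 2 :=
        (Real.sq_sqrt (wsq_inv_Gam_nonneg hpen _)).symm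
    _ ≤ _ := pow_le_pow_left₀ (Real.sqrt_nonneg _) hle 2

theorem sum_om_le_iSup_mul {om : V → ℝ} (hom : ∀ i, 0 ≤ om i) {D : Set (V × Fin M → ℝ)}
    (hD : ∃ C : ℝ, ∀ a ∈ D, ∀ b ∈ D, l2norm (a - b) ≤ C) {a b : V × Fin M → ℝ} (ha : a ∈ D)
    (hb : b ∈ D) : ∑ p : V × Fin M, om p.1 * (a p - b p) ^ 2 ≤ (⨆ i, om i) * dX D ^ 2 := by
  calc _ ≤ ∑ p : V × Fin M, (⨆ i, om i) * (a p - b p) ^ 2 :=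
        Finset.sum_le_sum fun p _ => mul_le_mul_of_nonneg_right
          (le_ciSup (Set.finite_range om).bddAbove p.1) (sq_nonneg _)
    _ = (⨆ i, om i) * l2norm (a - b) ^ 2 := by
        rw [l2norm_sq, Finset.mul_sum]
        rfl
    _ ≤ _ := mul_le_mul_of_nonneg_left
        (pow_le_pow_left₀ (l2norm_nonneg _) (l2norm_sub_le_dX hD ha hb) 2) (Real.iSup_nonneg hom)

end Constants

/-! ### Pathwise bound at the ergodic averages. -/

section Ergodic

variable {V : Type*} [Fintype V] [DecidableEq V] {G : SimpleGraph V} [DecidableRel G.Adj] {M : ℕ}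
  {g : V → EuclideanSpace ℝ (Fin M) → ℝ}
  {h : V → EuclideanSpace ℝ (Fin M) → EReal} {pen : G.Dart → ℝ} {om : V → ℝ}
  {Ω : Type*} {S : V → Type*}
  {gt : ∀ i, EuclideanSpace ℝ (Fin M) → S i → EuclideanSpace ℝ (Fin M)}
  {eta : ℕ → ℝ} {xi : ℕ → Ω → ∀ i, S i}
  {x0 : V × Fin M → ℝ} {z0 : G.Dart × Fin M → ℝ} {l0 : (G.Dart × Fin M) ⊕ (G.Dart × Fin M) → ℝ}
  {x : ℕ → Ω → V × Fin M → ℝ} {z : ℕ → Ω → G.Dart × Fin M → ℝ}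
  {l : ℕ → Ω → (G.Dart × Fin M) ⊕ (G.Dart × Fin M) → ℝ}

theorem IsRun.avg_mem_dom (hb : ∀ i y, h i y ≠ ⊥) (hc : ∀ i, EConvex (h i))
    (hpen : ∀ e, 0 < pen e) (hx0 : x0 ∈ effDom (hSum h))
    (hrun : IsRun h gt pen om eta xi x0 z0 l0 x z l) {r : ℕ} (hr : 0 < r) (w : Ω) :
    avg x r w ∈ effDom (hSum h) := by
  rw [avg_eq_sum_range]
  refine (convexOn_hSum hb hc).1.sum_mem (fun _ _ => by positivity) ?_
    fun t _ => hrun.mem_dom hpen hx0 (t + 1) w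
  have : (r : ℝ) ≠ 0 := by positivity
  simp [this]

/-- Jensen for f and linearity of the residual. The multiplier is chosen after the path, aligned
with the residual of the averages. -/
theorem gap_avg_le_sum (hg_convex : ∀ i, ConvexOn ℝ Set.univ (g i)) (hb : ∀ i y, h i y ≠ ⊥)
    (hc : ∀ i, EConvex (h i)) {ystar : EuclideanSpace ℝ (Fin M)} {r : ℕ} (hr : 0 < r) (w : Ω)
    (hx : ∀ t, x t w ∈ effDom (hSum h)) {rho : ℝ} (hrho : 0 ≤ rho) :
    ∃ lam : (G.Dart × Fin M) ⊕ (G.Dart × Fin M) → ℝ, l2norm lam ≤ rho ∧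
      gap G g h rho ystar (avg x r w) (avg z r w) ≤ 1 / (r : ℝ) * ∑ t ∈ Finset.range r,
        ((fSum g h (x (t + 1) w)).toReal - (fSum g h (copies V ystar)).toReal
          + lam ⬝ᵥ (A G M *ᵥ x (t + 1) w + B G M *ᵥ z (t + 1) w)) := by
  obtain ⟨lam, hlam, heq⟩ := exists_dotProduct_eq_mul_l2norm
    (A G M *ᵥ avg x r w + B G M *ᵥ avg z r w) hrho
  refine ⟨lam, hlam, ?_⟩
  have hr' : (r : ℝ) ≠ 0 := by positivity
  have hsum : ∑ _t ∈ Finset.range r, (1 / (r : ℝ)) = 1 := by simp [hr']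
  have h₁ := (convexOn_toReal_fSum hg_convex hb hc).map_sum_le (t := Finset.range r)
    (w := fun _ => 1 / (r : ℝ)) (p := fun t => x (t + 1) w) (fun _ _ => by positivity) hsum
    (fun t _ => hx (t + 1))
  have h₂ : lam ⬝ᵥ (A G M *ᵥ avg x r w + B G M *ᵥ avg z r w) = 1 / (r : ℝ) *
      ∑ t ∈ Finset.range r, lam ⬝ᵥ (A G M *ᵥ x (t + 1) w + B G M *ᵥ z (t + 1) w) := by
    rw [avg_eq_sum_range, avg_eq_sum_range, Matrix.mulVec_sum, Matrix.mulVec_sum,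
      ← Finset.sum_add_distrib, dotProduct_sum, Finset.mul_sum]
    refine Finset.sum_congr rfl fun t _ => ?_
    rw [Matrix.mulVec_smul, Matrix.mulVec_smul, ← smul_add, dotProduct_smul, smul_eq_mul]
  rw [gap, ← heq, h₂, Finset.sum_add_distrib, Finset.sum_sub_distrib, Finset.sum_const,
    Finset.card_range, nsmul_eq_mul]
  rw [← avg_eq_sum_range] at h₁
  simp only [smul_eq_mul, ← Finset.mul_sum] at h₁
  have h₃ : 1 / (r : ℝ) * (r * (fSum g h (copies V ystar)).toReal)
      = (fSum g h (copies V ystar)).toReal := by field_simp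
  rw [mul_add, mul_sub, h₃]
  linarith

/-- The deterministic bound of the gap at the ergodic averages along a path. -/
theorem IsRun.gap_avg_le (hg_convex : ∀ i, ConvexOn ℝ Set.univ (g i))
    (hg_diff : ∀ i, Differentiable ℝ (g i)) (hb : ∀ i y, h i y ≠ ⊥) (hc : ∀ i, EConvex (h i))
    {P : V → ℝ}
    (hg_lip : ∀ i, ∀ y ∈ effDom (h i), ∀ v ∈ effDom (h i),
      ‖gradient (g i) y - gradient (g i) v‖ ≤ P i * ‖y - v‖)
    {ystar : EuclideanSpace ℝ (Fin M)} (hy : copies V ystar ∈ effDom (hSum h))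
    (hbdd : ∃ C : ℝ, ∀ a ∈ effDom (hSum h), ∀ b ∈ effDom (hSum h), l2norm (a - b) ≤ C)
    (hpen : ∀ e, 0 < pen e) (hom : ∀ i, 0 ≤ om i)
    (hstep : ((2 : ℝ) • nodeDiag M om + Mplus G M * XiI M pen * (Mplus G M)ᵀ
      - (2 : ℝ) • nodeDiag M P).PosDef)
    (heta : ∀ r : ℕ, eta (r + 1) = Real.sqrt ((r : ℝ) + 1))
    (hx0 : x0 ∈ effDom (hSum h)) (hrun : IsRun h gt pen om eta xi x0 z0 l0 x z l)
    {rho : ℝ} (hrho : 0 ≤ rho) {r : ℕ} (hr : 0 < r) (w : Ω) :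
    gap G g h rho ystar (avg x r w) (avg z r w) ≤ 1 / (r : ℝ) *
      (∑ t ∈ Finset.range r,
          (gradVec g (x t w) - stochGrad gt (x t w) (xi (t + 1) w)) ⬝ᵥ (x t w - copies V ystar)
        + ∑ t ∈ Finset.range r, 1 / (2 * Real.sqrt ((t : ℝ) + 1)) *
          l2norm (stochGrad gt (x t w) (xi (t + 1) w) - gradVec g (x t w)) ^ 2
        + Real.sqrt r / 2 * dX (effDom (hSum h)) ^ 2
        + 1 / 2 * (dZ pen (effDom (hSum h)) ^ 2 + dLam pen l0 rho ^ 2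
          + (⨆ i, om i) * dX (effDom (hSum h)) ^ 2)) := by
  obtain ⟨lam, hlam, hgap⟩ := gap_avg_le_sum (z := z) (G := G) (ystar := ystar) hg_convex hb hc hr w
    (fun t => hrun.mem_dom hpen hx0 t w) hrho
  refine hgap.trans (mul_le_mul_of_nonneg_left ?_ (by positivity))
  have hsum := Finset.sum_le_sum fun t (_ : t ∈ Finset.range r) =>
    hrun.step_estimate hg_convex hg_diff hb hc hg_lip hy hpen hstep hx0 t
      (by rw [heta]; exact Real.sqrt_pos.2 (by positivity)) w lam
  refine hsum.trans ?_
  simp only [heta, Finset.sum_add_distrib, ← Finset.mul_sum]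
  -- The final distances left by telescoping are nonnegative and are dropped (`h₃`, `h₅`, `h₇`).
  rw [Finset.sum_range_sub' (fun t => wsq (Gam M pen)⁻¹ (lam - l t w)),
    Finset.sum_range_sub' (fun t => ∑ e : G.Dart × Fin M, pen e.1 * (z t w e - ystar e.2) ^ 2),
    Finset.sum_range_sub' (fun t => ∑ p : V × Fin M, om p.1 * (x t w p - copies V ystar p) ^ 2)]
  have h₁ : ∑ t ∈ Finset.range r, Real.sqrt ((t : ℝ) + 1) / 2 *
        (l2norm (x t w - copies V ystar) ^ 2 - l2norm (x (t + 1) w - copies V ystar) ^ 2)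
      ≤ Real.sqrt r / 2 * dX (effDom (hSum h)) ^ 2 := by
    have := sum_sqrt_mul_sub_le (a := fun t => l2norm (x t w - copies V ystar) ^ 2)
      (D := dX (effDom (hSum h)) ^ 2) (fun t => pow_le_pow_left₀ (l2norm_nonneg _)
        (l2norm_sub_le_dX hbdd (hrun.mem_dom hpen hx0 t w) hy) 2) r
    have h₂ : 0 ≤ Real.sqrt r * l2norm (x r w - copies V ystar) ^ 2 := by positivity
    simp only [div_mul_eq_mul_div, ← Finset.sum_div]
    linarith
  have h₂ : wsq (Gam M pen)⁻¹ (lam - l 0 w) ≤ dLam pen l0 rho ^ 2 := by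
    rw [hrun.l_zero]
    exact wsq_le_dLam_sq hpen l0 hlam
  have h₃ := wsq_inv_Gam_nonneg hpen (lam - l r w)
  have h₄ := sum_link_le_dZ_sq hpen hbdd hy (hrun.mem_dom hpen hx0 0 w)
    (hrun.z_eq_average hpen 0 w)
  have h₅ : 0 ≤ ∑ e : G.Dart × Fin M, pen e.1 * (z r w e - ystar e.2) ^ 2 :=
    Finset.sum_nonneg fun e _ => mul_nonneg (hpen e.1).le (sq_nonneg _)
  have h₆ := sum_om_le_iSup_mul hom hbdd (hrun.mem_dom hpen hx0 0 w) hy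
  have h₇ : 0 ≤ ∑ p : V × Fin M, om p.1 * (x r w p - copies V ystar p) ^ 2 :=
    Finset.sum_nonneg fun p _ => mul_nonneg (hom p.1) (sq_nonneg _)
  linarith

end Ergodic

/-! ### Expectations of functions of two independent variables. -/

section Decoupling

variable {Ω E F : Type*} [MeasurableSpace Ω] [MeasurableSpace E] [MeasurableSpace F]
  {μ : Measure Ω} [IsProbabilityMeasure μ] {X : Ω → E} {Y : Ω → F}

/-- The joint law of independent variables is the law of a pair of independent copies. -/
theorem map_pair_eq_map_prodMap (hX : Measurable X) (hY : Measurable Y) (hind : IndepFun X Y μ) :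
    μ.map (fun w => (X w, Y w)) = (μ.prod μ).map (Prod.map X Y) := by
  rw [(indepFun_iff_map_prod_eq_prod_map_map hX.aemeasurable hY.aemeasurable).1 hind,
    Measure.map_prod_map μ μ hX hY]

theorem integrable_comp_pair_iff (hX : Measurable X) (hY : Measurable Y) (hind : IndepFun X Y μ)
    {f : E × F → ℝ} (hf : Measurable f) :
    Integrable (fun w => f (X w, Y w)) μ ↔
      Integrable (fun p : Ω × Ω => f (X p.1, Y p.2)) (μ.prod μ) := by
  have h₁ := integrable_map_measure (μ := μ) (f := fun w => (X w, Y w)) (g := f)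
    hf.aestronglyMeasurable (hX.prodMk hY).aemeasurable
  have h₂ := integrable_map_measure (μ := μ.prod μ) (f := Prod.map X Y) (g := f)
    hf.aestronglyMeasurable (hX.prodMap hY).aemeasurable
  rw [map_pair_eq_map_prodMap hX hY hind] at h₁
  exact h₁.symm.trans h₂

theorem integral_comp_pair (hX : Measurable X) (hY : Measurable Y) (hind : IndepFun X Y μ)
    {f : E × F → ℝ} (hf : Measurable f) :
    ∫ w, f (X w, Y w) ∂μ = ∫ p : Ω × Ω, f (X p.1, Y p.2) ∂(μ.prod μ) := by
  have h₁ := integral_map (μ := μ) (φ := fun w => (X w, Y w)) (f := f)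
    (hX.prodMk hY).aemeasurable hf.aestronglyMeasurable
  have h₂ := integral_map (μ := μ.prod μ) (φ := Prod.map X Y) (f := f)
    (hX.prodMap hY).aemeasurable hf.aestronglyMeasurable
  rw [map_pair_eq_map_prodMap hX hY hind] at h₁
  exact h₁.symm.trans h₂

/-- A uniform bound of the conditional means of a nonnegative function is a bound of its mean. -/
theorem integrable_and_integral_le_of_indepFun (hX : Measurable X) (hY : Measurable Y)
    (hind : IndepFun X Y μ) {f : E × F → ℝ} (hf : Measurable f) (hnn : ∀ p, 0 ≤ f p) {c : ℝ}
    (hint : ∀ w, Integrable (fun w' => f (X w, Y w')) μ)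
    (hle : ∀ w, ∫ w', f (X w, Y w') ∂μ ≤ c) :
    Integrable (fun w => f (X w, Y w)) μ ∧ ∫ w, f (X w, Y w) ∂μ ≤ c := by
  have hm : Measurable fun p : Ω × Ω => f (X p.1, Y p.2) := hf.comp (hX.prodMap hY)
  -- Inner integrals lie between 0 and c, so they are integrable; Tonelli's criterion then gives
  -- integrability on the product.
  have hmi : StronglyMeasurable fun w => ∫ w', f (X w, Y w') ∂μ :=
    hm.stronglyMeasurable.integral_prod_right'
  have hint₂ : Integrable (fun w => ∫ w', f (X w, Y w') ∂μ) μ :=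
    Integrable.of_bound hmi.aestronglyMeasurable c (.of_forall fun w => by
      rw [Real.norm_of_nonneg (integral_nonneg fun _ => hnn _)]; exact hle w)
  have hint₃ : Integrable (fun p : Ω × Ω => f (X p.1, Y p.2)) (μ.prod μ) := by
    rw [integrable_prod_iff hm.aestronglyMeasurable]
    refine ⟨.of_forall hint, ?_⟩
    simpa only [Real.norm_of_nonneg (hnn _)] using hint₂
  refine ⟨(integrable_comp_pair_iff hX hY hind hf).2 hint₃, ?_⟩
  rw [integral_comp_pair hX hY hind hf, integral_prod _ hint₃]
  calc _ ≤ ∫ _, c ∂μ := integral_mono hint₂ (integrable_const c) hle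
    _ = c := by simp

theorem integral_eq_zero_of_indepFun (hX : Measurable X) (hY : Measurable Y)
    (hind : IndepFun X Y μ) {f : E × F → ℝ} (hf : Measurable f)
    (hint : Integrable (fun w => f (X w, Y w)) μ) (h0 : ∀ w, ∫ w', f (X w, Y w') ∂μ = 0) :
    ∫ w, f (X w, Y w) ∂μ = 0 := by
  rw [integral_comp_pair hX hY hind hf,
    integral_prod _ ((integrable_comp_pair_iff hX hY hind hf).1 hint)]
  simp [h0]

end Decoupling

/-- A function that is Lipschitz in a measurable function is measurable. -/
theorem measurable_of_dist_le {Ω α ι : Type*} [MeasurableSpace Ω] [PseudoMetricSpace α]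
    [MeasurableSpace α] [OpensMeasurableSpace α] [Fintype ι] {C : Ω → α} {X : Ω → ι → ℝ} {K : NNReal}
    (hC : Measurable C) (hle : ∀ w w', dist (X w) (X w') ≤ K * dist (C w) (C w')) :
    Measurable X := by
  have hfac : Function.FactorsThrough X C := fun w w' hww => by
    have := hle w w'
    rw [hww, dist_self, mul_zero] at this
    exact dist_le_zero.1 this
  have hlip : LipschitzOnWith K (Function.extend C X 0) (Set.range C) := by
    refine LipschitzOnWith.of_dist_le_mul ?_
    rintro _ ⟨w, rfl⟩ _ ⟨w', rfl⟩
    rw [hfac.extend_apply, hfac.extend_apply]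
    exact hle w w'
  -- Lipschitz extension coordinate by coordinate, off the range of `C`: no measurability of that
  -- range is needed.
  obtain ⟨T, hT, heq⟩ := hlip.extend_pi
  have : X = T ∘ C := by
    ext1 w
    rw [Function.comp_apply, ← heq ⟨w, rfl⟩, hfac.extend_apply]
  rw [this]
  exact hT.continuous.measurable.comp hC

/-! ### Measurability of the iterates and independence from future samples. -/

section Iterates

variable {V : Type*} [Fintype V] [DecidableEq V] {G : SimpleGraph V} [DecidableRel G.Adj] {M : ℕ}
  {g : V → EuclideanSpace ℝ (Fin M) → ℝ}
  {h : V → EuclideanSpace ℝ (Fin M) → EReal} {pen : G.Dart → ℝ} {om : V → ℝ}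
  {Ω : Type*} {S : V → Type*}
  {gt : ∀ i, EuclideanSpace ℝ (Fin M) → S i → EuclideanSpace ℝ (Fin M)}
  {eta : ℕ → ℝ} {xi : ℕ → Ω → ∀ i, S i}
  {x0 : V × Fin M → ℝ} {z0 : G.Dart × Fin M → ℝ} {l0 : (G.Dart × Fin M) ⊕ (G.Dart × Fin M) → ℝ}
  {x : ℕ → Ω → V × Fin M → ℝ} {z : ℕ → Ω → G.Dart × Fin M → ℝ}
  {l : ℕ → Ω → (G.Dart × Fin M) ⊕ (G.Dart × Fin M) → ℝ}

/-- The linear term of the objective of the `x`-update. -/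
noncomputable def xLin (pen : G.Dart → ℝ) (om : V → ℝ) (eta : ℝ) (Gt x' : V × Fin M → ℝ)
    (z' : G.Dart × Fin M → ℝ) (l' : (G.Dart × Fin M) ⊕ (G.Dart × Fin M) → ℝ) : V × Fin M → ℝ :=
  fun p => Gt p + (∑ e : G.Dart × Fin M,
      ((l' (.inl e) - pen e.1 * z' e) * (if p = (e.1.fst, e.2) then 1 else 0)
        + (l' (.inr e) - pen e.1 * z' e) * (if p = (e.1.snd, e.2) then 1 else 0)))
    - (om p.1 + eta) * x' p

/-- Everything random in the x-update apart from the minimizer itself is collected in one vector,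
the linear term. -/
theorem xSlope_eq_xLin (pen : G.Dart → ℝ) (om : V → ℝ) (eta : ℝ) (Gt x' : V × Fin M → ℝ)
    (z' : G.Dart × Fin M → ℝ) (l' : (G.Dart × Fin M) ⊕ (G.Dart × Fin M) → ℝ)
    (x d : V × Fin M → ℝ) :
    xSlope pen om eta Gt x' z' l' x d = ∑ p, xLin pen om eta Gt x' z' l' p * d p
      + ∑ e : G.Dart × Fin M, pen e.1 *
        (x (e.1.fst, e.2) * d (e.1.fst, e.2) + x (e.1.snd, e.2) * d (e.1.snd, e.2))
      + ∑ p, (om p.1 + eta) * x p * d p := by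
  have h₁ : ∑ p, (∑ e : G.Dart × Fin M,
      ((l' (.inl e) - pen e.1 * z' e) * (if p = (e.1.fst, e.2) then 1 else 0)
        + (l' (.inr e) - pen e.1 * z' e) * (if p = (e.1.snd, e.2) then 1 else 0))) * d p
      = ∑ e : G.Dart × Fin M, ((l' (.inl e) - pen e.1 * z' e) * d (e.1.fst, e.2)
        + (l' (.inr e) - pen e.1 * z' e) * d (e.1.snd, e.2)) := by
    simp only [Finset.sum_mul]
    rw [Finset.sum_comm]
    refine Finset.sum_congr rfl fun e _ => ?_
    simp [add_mul, Finset.sum_add_distrib]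
  have h₀ : ∑ p, xLin pen om eta Gt x' z' l' p * d p = ∑ p, Gt p * d p
      + ∑ e : G.Dart × Fin M, ((l' (.inl e) - pen e.1 * z' e) * d (e.1.fst, e.2)
        + (l' (.inr e) - pen e.1 * z' e) * d (e.1.snd, e.2))
      - ∑ p : V × Fin M, (om p.1 + eta) * x' p * d p := by
    rw [← h₁, ← Finset.sum_add_distrib, ← Finset.sum_sub_distrib]
    exact Finset.sum_congr rfl fun p _ => by rw [xLin]; ring
  rw [h₀, xSlope]
  have h₂ : ∑ p : V × Fin M, (om p.1 + eta) * (x p - x' p) * d p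
      = ∑ p : V × Fin M, (om p.1 + eta) * x p * d p
        - ∑ p : V × Fin M, (om p.1 + eta) * x' p * d p := by
    rw [← Finset.sum_sub_distrib]
    exact Finset.sum_congr rfl fun p _ => by ring
  have h₃ : ∑ e : G.Dart × Fin M,
      ((pen e.1 * (x (e.1.fst, e.2) - z' e) + l' (.inl e)) * d (e.1.fst, e.2)
        + (pen e.1 * (x (e.1.snd, e.2) - z' e) + l' (.inr e)) * d (e.1.snd, e.2))
      = ∑ e : G.Dart × Fin M, ((l' (.inl e) - pen e.1 * z' e) * d (e.1.fst, e.2)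
        + (l' (.inr e) - pen e.1 * z' e) * d (e.1.snd, e.2))
        + ∑ e : G.Dart × Fin M, pen e.1 *
        (x (e.1.fst, e.2) * d (e.1.fst, e.2) + x (e.1.snd, e.2) * d (e.1.snd, e.2)) := by
    rw [← Finset.sum_add_distrib]
    exact Finset.sum_congr rfl fun e _ => by ring
  rw [h₂, h₃]
  ring

/-- The `x`-update is a Lipschitz function of the linear term of its objective. -/
theorem IsRun.dist_x_succ_le (hpen : ∀ e, 0 < pen e) (hom : ∀ i, 0 ≤ om i)
    (hb : ∀ i y, h i y ≠ ⊥) (hc : ∀ i, EConvex (h i)) (hx0 : x0 ∈ effDom (hSum h))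
    (hrun : IsRun h gt pen om eta xi x0 z0 l0 x z l) (r : ℕ) (heta : 0 < eta (r + 1)) (w w' : Ω) :
    dist (x (r + 1) w) (x (r + 1) w') ≤ (Fintype.card (V × Fin M) / eta (r + 1)) *
      dist (xLin pen om (eta (r + 1)) (stochGrad gt (x r w) (xi (r + 1) w)) (x r w) (z r w) (l r w))
        (xLin pen om (eta (r + 1)) (stochGrad gt (x r w') (xi (r + 1) w')) (x r w') (z r w')
          (l r w')) := by
  have h₁ := hrun.x_step_optimality hpen hb hc hx0 r w (hrun.mem_dom hpen hx0 (r + 1) w')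
  have h₂ := hrun.x_step_optimality hpen hb hc hx0 r w' (hrun.mem_dom hpen hx0 (r + 1) w)
  rw [xSlope_eq_xLin] at h₁ h₂
  generalize xLin pen om (eta (r + 1)) (stochGrad gt (x r w) (xi (r + 1) w)) (x r w) (z r w)
    (l r w) = c at *
  generalize xLin pen om (eta (r + 1)) (stochGrad gt (x r w') (xi (r + 1) w')) (x r w') (z r w')
    (l r w') = c' at *
  generalize x (r + 1) w = a at *
  generalize x (r + 1) w' = a' at *
  generalize eta (r + 1) = s at *
  -- Adding the two optimality conditions, each tested at the other minimizer, cancels h; the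
  -- quadratic part is strongly monotone with modulus s.
  have h₃ : s * ∑ p, (a p - a' p) ^ 2 ≤ ∑ p, (c p - c' p) * (a' p - a p) := by
    have e₁ : ∑ p, (c p - c' p) * (a' p - a p)
        = ∑ p, c p * (a' - a) p + ∑ p, c' p * (a - a') p := by
      rw [← Finset.sum_add_distrib]
      exact Finset.sum_congr rfl fun p _ => by simp only [Pi.sub_apply]; ring
    have e₂ : ∑ e : G.Dart × Fin M, pen e.1 * (a (e.1.fst, e.2) * (a' - a) (e.1.fst, e.2)
          + a (e.1.snd, e.2) * (a' - a) (e.1.snd, e.2))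
        + ∑ e : G.Dart × Fin M, pen e.1 * (a' (e.1.fst, e.2) * (a - a') (e.1.fst, e.2)
          + a' (e.1.snd, e.2) * (a - a') (e.1.snd, e.2)) ≤ 0 := by
      rw [← Finset.sum_add_distrib]
      refine Finset.sum_nonpos fun e _ => ?_
      have := mul_nonneg (hpen e.1).le (add_nonneg
        (sq_nonneg (a (e.1.fst, e.2) - a' (e.1.fst, e.2)))
        (sq_nonneg (a (e.1.snd, e.2) - a' (e.1.snd, e.2))))
      simp only [Pi.sub_apply]
      linarith
    have e₃ : ∑ p : V × Fin M, (om p.1 + s) * a p * (a' - a) p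
        + ∑ p : V × Fin M, (om p.1 + s) * a' p * (a - a') p
        ≤ - (s * ∑ p, (a p - a' p) ^ 2) := by
      rw [← Finset.sum_add_distrib, Finset.mul_sum, ← Finset.sum_neg_distrib]
      refine Finset.sum_le_sum fun p _ => ?_
      have := mul_nonneg (hom p.1) (sq_nonneg (a p - a' p))
      simp only [Pi.sub_apply]
      linarith
    linarith
  -- Distances on functions are sup distances, which is where the cardinality enters.
  have h₄ : ∑ p, (c p - c' p) * (a' p - a p)
      ≤ Fintype.card (V × Fin M) * (dist c c' * dist a a') := by
    rw [← Finset.card_univ, ← nsmul_eq_mul]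
    refine Finset.sum_le_card_nsmul _ _ _ fun p _ => ?_
    refine (le_abs_self _).trans ?_
    rw [abs_mul, abs_sub_comm (a' p), ← Real.dist_eq, ← Real.dist_eq]
    exact mul_le_mul (dist_le_pi_dist c c' p) (dist_le_pi_dist a a' p) dist_nonneg dist_nonneg
  have h₅ : dist a a' ^ 2 ≤ ∑ p, (a p - a' p) ^ 2 := by
    refine (Real.le_sqrt dist_nonneg (Finset.sum_nonneg fun p _ => sq_nonneg _)).1 ?_
    refine (dist_pi_le_iff (Real.sqrt_nonneg _)).2 fun p => ?_
    rw [Real.dist_eq]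
    refine Real.abs_le_sqrt ?_
    exact Finset.single_le_sum (f := fun p => (a p - a' p) ^ 2) (fun p _ => sq_nonneg _)
      (Finset.mem_univ p)
  -- One factor `dist a a'` has to be cancelled.
  rcases (dist_nonneg (x := a) (y := a')).eq_or_lt with h0 | h0
  · rw [← h0]; positivity
  · rw [div_mul_eq_mul_div, le_div_iff₀ heta]
    have : s * dist a a' ^ 2 ≤ Fintype.card (V × Fin M) * (dist c c' * dist a a') :=
      (mul_le_mul_of_nonneg_left h₅ heta.le).trans (h₃.trans h₄)
    refine le_of_mul_le_mul_right ?_ h0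
    linarith

theorem measurable_blk {I : Type*} (i : I) :
    Measurable fun x : I × Fin M → ℝ => blk x i :=
  (WithLp.measurable_toLp 2 _).comp (measurable_pi_iff.2 fun k => measurable_pi_apply (i, k))

theorem measurable_stochGrad [∀ i, MeasurableSpace (S i)]
    (hgt : ∀ i, Measurable (Function.uncurry (gt i))) :
    Measurable fun q : (V × Fin M → ℝ) × (∀ i, S i) => stochGrad gt q.1 q.2 := by
  refine measurable_pi_iff.2 fun p => ?_
  have h₁ : Measurable fun q : (V × Fin M → ℝ) × (∀ i, S i) => gt p.1 (blk q.1 p.1) (q.2 p.1) :=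
    (hgt p.1).comp (((measurable_blk p.1).comp measurable_fst).prodMk
      ((measurable_pi_apply p.1).comp measurable_snd))
  exact (EuclideanSpace.proj (𝕜 := ℝ) p.2).continuous.measurable.comp h₁

/-- The iterates are measurable functions of the samples that have been used so far. -/
theorem IsRun.measurable_iterates [MeasurableSpace Ω] [∀ i, MeasurableSpace (S i)]
    (hgt : ∀ i, Measurable (Function.uncurry (gt i))) (hpen : ∀ e, 0 < pen e)
    (hom : ∀ i, 0 ≤ om i) (hb : ∀ i y, h i y ≠ ⊥) (hc : ∀ i, EConvex (h i))
    (heta : ∀ r, 0 < eta (r + 1)) (hx0 : x0 ∈ effDom (hSum h))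
    (hrun : IsRun h gt pen om eta xi x0 z0 l0 x z l) (r : ℕ)
    (hxi : ∀ s < r, Measurable (xi (s + 1))) :
    Measurable (x r) ∧ Measurable (z r) ∧ Measurable (l r) := by
  have hz : ∀ s, Measurable (x s) → Measurable (z s) := fun s hs => by
    refine measurable_pi_iff.2 fun e => ?_
    simp only [hrun.z_eq_average hpen s]
    exact (((measurable_pi_apply _).comp hs).add ((measurable_pi_apply _).comp hs)).div_const 2
  induction r with
  | zero =>
    have hx : Measurable (x 0) := by
      rw [funext hrun.x_zero]; exact measurable_const
    refine ⟨hx, hz 0 hx, ?_⟩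
    rw [funext hrun.l_zero]; exact measurable_const
  | succ r ih =>
    obtain ⟨h₁, h₂, h₃⟩ := ih fun s hs => hxi s (hs.trans r.lt_succ_self)
    have hG : Measurable fun w => stochGrad gt (x r w) (xi (r + 1) w) :=
      (measurable_stochGrad hgt).comp (h₁.prodMk (hxi r r.lt_succ_self))
    have hC : Measurable fun w => xLin pen om (eta (r + 1))
        (stochGrad gt (x r w) (xi (r + 1) w)) (x r w) (z r w) (l r w) := by
      refine measurable_pi_iff.2 fun p => ?_
      simp only [xLin]
      fun_prop
    have hx : Measurable (x (r + 1)) := by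
      have hnn : 0 ≤ (Fintype.card (V × Fin M) : ℝ) / eta (r + 1) :=
        div_nonneg (Nat.cast_nonneg _) (heta r).le
      exact measurable_of_dist_le (K := ⟨_, hnn⟩) hC
        (hrun.dist_x_succ_le hpen hom hb hc hx0 r (heta r))
    have hz' := hz (r + 1) hx
    refine ⟨hx, hz', measurable_pi_iff.2 ?_⟩
    rintro (e | e)
    · simp only [hrun.l_step_inl]
      fun_prop
    · simp only [hrun.l_step_inr]
      fun_prop

/-- The current iterate is independent of the next sample. -/
theorem IsRun.indepFun_x [MeasurableSpace Ω] {μ : Measure Ω} [∀ i, MeasurableSpace (S i)]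
    (hgt : ∀ i, Measurable (Function.uncurry (gt i))) (hpen : ∀ e, 0 < pen e)
    (hom : ∀ i, 0 ≤ om i) (hb : ∀ i y, h i y ≠ ⊥) (hc : ∀ i, EConvex (h i))
    (heta : ∀ r, 0 < eta (r + 1)) (hx0 : x0 ∈ effDom (hSum h))
    (hxi : ∀ r, Measurable (xi (r + 1))) (hind : iIndepFun (fun r => xi (r + 1)) μ)
    (hrun : IsRun h gt pen om eta xi x0 z0 l0 x z l) (r : ℕ) :
    IndepFun (x r) (xi (r + 1)) μ := by
  have hdis : Disjoint {s | s < r} {r} := by simp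
  have h₁ := indep_iSup_of_disjoint (fun s => (hxi s).comap_le) hind.iIndep hdis
  rw [IndepFun_iff_Indep]
  -- Measurability of the iterates is applied with the σ-algebra of the samples `xi 1`, …, `xi r` in
  -- place of the ambient one.
  have hx : Measurable[⨆ s ∈ {s | s < r}, MeasurableSpace.comap (xi (s + 1)) inferInstance] (x r) := by
    refine (@IsRun.measurable_iterates V _ _ G _ M h pen om Ω S gt eta xi x0 z0 l0 x z l
      (⨆ s ∈ {s | s < r}, MeasurableSpace.comap (xi (s + 1)) inferInstance) _ hgt hpen hom hb hc heta
      hx0 hrun r fun s hs => ?_).1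
    exact Measurable.of_comap_le (le_iSup₂_of_le s hs le_rfl)
  refine indep_of_indep_of_le_left (indep_of_indep_of_le_right h₁ ?_) hx.comap_le
  exact le_iSup₂_of_le r rfl le_rfl

end Iterates

/-! ### Noise moments and integrability of the gap. -/

section Expectation

variable {V : Type*} [Fintype V] [DecidableEq V] {G : SimpleGraph V} [DecidableRel G.Adj] {M : ℕ}
  {g : V → EuclideanSpace ℝ (Fin M) → ℝ}
  {h : V → EuclideanSpace ℝ (Fin M) → EReal} {pen : G.Dart → ℝ} {om : V → ℝ}
  {Ω : Type*} {S : V → Type*}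
  {gt : ∀ i, EuclideanSpace ℝ (Fin M) → S i → EuclideanSpace ℝ (Fin M)}
  {eta : ℕ → ℝ} {xi : ℕ → Ω → ∀ i, S i}
  {x0 : V × Fin M → ℝ} {z0 : G.Dart × Fin M → ℝ} {l0 : (G.Dart × Fin M) ⊕ (G.Dart × Fin M) → ℝ}
  {x : ℕ → Ω → V × Fin M → ℝ} {z : ℕ → Ω → G.Dart × Fin M → ℝ}
  {l : ℕ → Ω → (G.Dart × Fin M) ⊕ (G.Dart × Fin M) → ℝ}

theorem measurable_l2norm {I : Type*} [Fintype I] : Measurable (l2norm : (I → ℝ) → ℝ) :=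
  (PiLp.continuous_toLp 2 _).norm.measurable

theorem measurable_gradVec (g : V → EuclideanSpace ℝ (Fin M) → ℝ) :
    Measurable (gradVec g) := by
  refine measurable_pi_iff.2 fun p => ?_
  have h₁ : Measurable (gradient (g p.1)) :=
    (InnerProductSpace.toDual ℝ _).symm.continuous.measurable.comp (measurable_fderiv ℝ (g p.1))
  exact (EuclideanSpace.proj (𝕜 := ℝ) p.2).continuous.measurable.comp
    (h₁.comp (measurable_blk p.1))

/-- The mean squared error of the gradient estimate at an independent point. -/
theorem integral_error_sq_le [MeasurableSpace Ω] {μ : Measure Ω} [IsProbabilityMeasure μ]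
    [∀ i, MeasurableSpace (S i)] (hgt : ∀ i, Measurable (Function.uncurry (gt i)))
    {s : Ω → ∀ i, S i} (hs : Measurable s) {X : Ω → V × Fin M → ℝ} (hX : Measurable X)
    (hind : IndepFun X s μ) {D : Set (V × Fin M → ℝ)} (hD : ∀ w, X w ∈ D) {c : ℝ}
    (hvar : ∀ a ∈ D,
      Integrable (fun w => l2norm (stochGrad gt a (s w) - gradVec g a) ^ 2) μ ∧
      ∫ w, l2norm (stochGrad gt a (s w) - gradVec g a) ^ 2 ∂μ ≤ c) :
    Integrable (fun w => l2norm (stochGrad gt (X w) (s w) - gradVec g (X w)) ^ 2) μ ∧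
      ∫ w, l2norm (stochGrad gt (X w) (s w) - gradVec g (X w)) ^ 2 ∂μ ≤ c := by
  have hm : Measurable fun q : (V × Fin M → ℝ) × (∀ i, S i) =>
      l2norm (stochGrad gt q.1 q.2 - gradVec g q.1) ^ 2 :=
    (measurable_l2norm.comp ((measurable_stochGrad hgt).sub
      ((measurable_gradVec g).comp measurable_fst))).pow_const 2
  exact integrable_and_integral_le_of_indepFun hX hs hind hm (fun _ => sq_nonneg _)
    (fun w => (hvar _ (hD w)).1) fun w => (hvar _ (hD w)).2

/-- The gradient error at an independent point is uncorrelated with the displacement of that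
point. -/
theorem integral_error_dotProduct_eq_zero [MeasurableSpace Ω] {μ : Measure Ω}
    [IsProbabilityMeasure μ] [∀ i, MeasurableSpace (S i)] (hb : ∀ i y, h i y ≠ ⊥)
    (hgt : ∀ i, Measurable (Function.uncurry (gt i)))
    {s : Ω → ∀ i, S i} (hs : Measurable s) {X : Ω → V × Fin M → ℝ} (hX : Measurable X)
    (hind : IndepFun X s μ) (hD : ∀ w, X w ∈ effDom (hSum h))
    (hunb : ∀ i, ∀ y ∈ effDom (h i), Integrable (fun w => gt i y (s w i)) μ ∧
        ∫ w, gt i y (s w i) ∂μ = gradient (g i) y)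
    (hsq : Integrable (fun w => l2norm (stochGrad gt (X w) (s w) - gradVec g (X w)) ^ 2) μ)
    (y : V × Fin M → ℝ) {C : ℝ} (hC : ∀ w, l2norm (X w - y) ≤ C) :
    Integrable (fun w => (gradVec g (X w) - stochGrad gt (X w) (s w)) ⬝ᵥ (X w - y)) μ ∧
      ∫ w, (gradVec g (X w) - stochGrad gt (X w) (s w)) ⬝ᵥ (X w - y) ∂μ = 0 := by
  have hm : Measurable fun q : (V × Fin M → ℝ) × (∀ i, S i) =>
      (gradVec g q.1 - stochGrad gt q.1 q.2) ⬝ᵥ (q.1 - y) := by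
    have h₁ := measurable_stochGrad (V := V) hgt
    have h₂ := measurable_gradVec g
    simp only [dotProduct]
    refine Finset.measurable_sum _ fun p _ => ?_
    exact ((measurable_pi_apply p).comp ((h₂.comp measurable_fst).sub h₁)).mul
      ((measurable_pi_apply p).comp (measurable_fst.sub_const y))
  -- The product is at most half the squared error plus half the squared displacement, and the
  -- latter is bounded.
  have hint : Integrable
      (fun w => (gradVec g (X w) - stochGrad gt (X w) (s w)) ⬝ᵥ (X w - y)) μ := by
    refine Integrable.mono' ((hsq.const_mul (1 / 2)).add (integrable_const (1 / 2 * C ^ 2)))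
      (hm.comp (hX.prodMk hs)).aestronglyMeasurable (.of_forall fun w => ?_)
    have h₁ : ‖(gradVec g (X w) - stochGrad gt (X w) (s w)) ⬝ᵥ (X w - y)‖
        ≤ 1 / 2 * l2norm (stochGrad gt (X w) (s w) - gradVec g (X w)) ^ 2
          + 1 / 2 * l2norm (X w - y) ^ 2 := by
      rw [l2norm_sq, l2norm_sq, Finset.mul_sum, Finset.mul_sum, ← Finset.sum_add_distrib]
      refine (norm_sum_le _ _).trans (Finset.sum_le_sum fun p _ => ?_)
      simp only [Pi.sub_apply]
      rw [Real.norm_eq_abs, abs_le]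
      constructor
      · nlinarith [sq_nonneg (stochGrad gt (X w) (s w) p - gradVec g (X w) p - (X w p - y p))]
      · nlinarith [sq_nonneg (stochGrad gt (X w) (s w) p - gradVec g (X w) p + (X w p - y p))]
    have h₂ := pow_le_pow_left₀ (l2norm_nonneg _) (hC w) 2
    simp only [Pi.add_apply]
    linarith
  refine ⟨hint, integral_eq_zero_of_indepFun hX hs hind hm hint fun w => ?_⟩
  simp only [dotProduct, Pi.sub_apply]
  have hcomp : ∀ p : V × Fin M, Integrable (fun w' => stochGrad gt (X w) (s w') p) μ ∧
      ∫ w', stochGrad gt (X w) (s w') p ∂μ = gradVec g (X w) p := fun p => by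
    obtain ⟨h₁, h₂⟩ := hunb p.1 _ ((mem_effDom_hSum hb).1 (hD w) p.1)
    refine ⟨(EuclideanSpace.proj (𝕜 := ℝ) p.2).integrable_comp h₁, ?_⟩
    have := (EuclideanSpace.proj (𝕜 := ℝ) p.2).integral_comp_comm h₁
    rw [h₂] at this
    exact this
  have hzero : ∀ p : V × Fin M, Integrable
      (fun w' => (gradVec g (X w) p - stochGrad gt (X w) (s w') p) * (X w p - y p)) μ ∧
      ∫ w', (gradVec g (X w) p - stochGrad gt (X w) (s w') p) * (X w p - y p) ∂μ = 0 := fun p => by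
    refine ⟨((integrable_const _).sub (hcomp p).1).mul_const _, ?_⟩
    rw [integral_mul_const, integral_sub (integrable_const _) (hcomp p).1, (hcomp p).2]
    simp
  rw [integral_finsetSum _ fun p _ => (hzero p).1]
  exact Finset.sum_eq_zero fun p _ => (hzero p).2

theorem continuous_blk {I : Type*} (i : I) :
    Continuous fun x : I × Fin M → ℝ => blk x i :=
  (PiLp.continuous_toLp 2 _).comp (continuous_pi fun k => continuous_apply (i, k))

theorem continuous_xQuad (pen : G.Dart → ℝ) (om : V → ℝ) (eta : ℝ) (Gt x' : V × Fin M → ℝ)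
    (z' : G.Dart × Fin M → ℝ) (l' : (G.Dart × Fin M) ⊕ (G.Dart × Fin M) → ℝ) :
    Continuous (xQuad pen om eta Gt x' z' l') := by
  unfold xQuad
  fun_prop

/-- The objective is bounded below on the domain of `h`. -/
theorem IsRun.exists_le_fSum [Nonempty Ω] (hg_diff : ∀ i, Differentiable ℝ (g i))
    (hb : ∀ i y, h i y ≠ ⊥)
    (hbdd : ∃ C : ℝ, ∀ a ∈ effDom (hSum h), ∀ b ∈ effDom (hSum h), l2norm (a - b) ≤ C)
    (hpen : ∀ e, 0 < pen e) (hx0 : x0 ∈ effDom (hSum h))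
    (hrun : IsRun h gt pen om eta xi x0 z0 l0 x z l) :
    ∃ K : ℝ, ∀ v ∈ effDom (hSum h), K ≤ (fSum g h v).toReal := by
  obtain ⟨C, hC⟩ := hbdd
  obtain ⟨w⟩ := ‹Nonempty Ω›
  -- The first x-update along any one path attains a minimum of h + q, so h ≥ const - q on the
  -- domain; g - q is continuous, hence bounded on a ball containing that domain.
  let q := xQuad pen om (eta (0 + 1)) (stochGrad gt (x 0 w) (xi (0 + 1) w)) (x 0 w) (z 0 w) (l 0 w)
  have hcont : Continuous fun v => ∑ i, g i (blk v i) - q v :=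
    (continuous_finsetSum _ fun i _ => (hg_diff i).continuous.comp (continuous_blk i)).sub
      (continuous_xQuad _ _ _ _ _ _ _)
  obtain ⟨K, hK⟩ := (isCompact_closedBall x0 C).exists_bound_of_continuousOn hcont.continuousOn
  refine ⟨(hSum h (x (0 + 1) w)).toReal + q (x (0 + 1) w) - K, fun v hv => ?_⟩
  have hmem : v ∈ Metric.closedBall x0 C := by
    refine Metric.mem_closedBall.2 ((dist_pi_le_iff ((l2norm_nonneg _).trans (hC v hv x0 hx0))).2
      fun p => ?_)
    refine le_trans ?_ (hC v hv x0 hx0)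
    exact PiLp.norm_apply_le (WithLp.toLp 2 (v - x0)) p
  have h₁ := (abs_le.1 (hK v hmem)).1
  have h₂ := hrun.x_step_real hpen hb hx0 0 w hv
  rw [toReal_fSum hb hv]
  linarith

theorem measurable_gap_comp [MeasurableSpace Ω] (hg_diff : ∀ i, Differentiable ℝ (g i))
    (hb : ∀ i y, h i y ≠ ⊥) (hh_meas : ∀ i, Measurable (h i)) (rho : ℝ)
    (ystar : EuclideanSpace ℝ (Fin M)) {X : Ω → V × Fin M → ℝ} {Z : Ω → G.Dart × Fin M → ℝ}
    (hX : Measurable X) (hZ : Measurable Z) (hD : ∀ w, X w ∈ effDom (hSum h)) :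
    Measurable fun w => gap G g h rho ystar (X w) (Z w) := by
  have h₁ : Measurable fun w => (fSum g h (X w)).toReal := by
    simp only [fun w => toReal_fSum (g := g) hb (hD w), fun w => toReal_hSum hb (hD w)]
    refine (Finset.measurable_sum _ fun i _ => ?_).add (Finset.measurable_sum _ fun i _ => ?_)
    · exact (hg_diff i).continuous.measurable.comp ((measurable_blk i).comp hX)
    · exact ((hh_meas i).comp ((measurable_blk i).comp hX)).ereal_toReal
  have h₂ : Measurable fun w => A G M *ᵥ X w + B G M *ᵥ Z w :=
    ((Continuous.matrix_mulVec continuous_const continuous_id).measurable.comp hX).add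
      ((Continuous.matrix_mulVec continuous_const continuous_id).measurable.comp hZ)
  exact (h₁.sub_const _).add ((measurable_l2norm.comp h₂).const_mul rho)

theorem measurable_avg [MeasurableSpace Ω] {I : Type*} {u : ℕ → Ω → I → ℝ}
    (hu : ∀ t, Measurable (u t)) (r : ℕ) : Measurable (avg u r) := by
  unfold avg
  exact (Finset.measurable_sum _ fun t _ => hu t).const_smul (1 / (r : ℝ))

theorem integrable_and_integral_affine [MeasurableSpace Ω] {μ : Measure Ω}
    [IsProbabilityMeasure μ] {u v : Ω → ℝ} (hu : Integrable u μ) (hv : Integrable v μ)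
    (c a b : ℝ) : Integrable (fun w => c * (u w + v w + a + b)) μ ∧
      ∫ w, c * (u w + v w + a + b) ∂μ = c * (∫ w, u w ∂μ + ∫ w, v w ∂μ + a + b) := by
  have h₁ : Integrable (fun w => u w + v w) μ := hu.add hv
  have h₂ : Integrable (fun w => u w + v w + a) μ := h₁.add (integrable_const a)
  have h₃ : Integrable (fun w => u w + v w + a + b) μ := h₂.add (integrable_const b)
  refine ⟨h₃.const_mul c, ?_⟩
  rw [integral_const_mul, integral_add h₂ (integrable_const b), integral_add h₁ (integrable_const a),
    integral_add hu hv]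
  simp

end Expectation

end DySPGC

/-! ### Assembly of the expectation bound. -/

theorem theorem4p2
    -- the network
    {V : Type*} [Fintype V] [DecidableEq V] (G : SimpleGraph V) [DecidableRel G.Adj]
    (hG : G.Connected) {M : ℕ}
    -- the objective
    (g : V → EuclideanSpace ℝ (Fin M) → ℝ) (h : V → EuclideanSpace ℝ (Fin M) → EReal)
    (hg_convex : ∀ i, ConvexOn ℝ Set.univ (g i)) (hg_diff : ∀ i, Differentiable ℝ (g i))
    (hh_bot : ∀ i y, h i y ≠ ⊥) (hh_convex : ∀ i, DySPGC.EConvex (h i))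
    (hh_meas : ∀ i, Measurable (h i))
    (P : V → ℝ) (hP : ∀ i, 0 < P i)
    (hg_lip : ∀ i, ∀ y ∈ DySPGC.effDom (h i), ∀ v ∈ DySPGC.effDom (h i),
      ‖gradient (g i) y - gradient (g i) v‖ ≤ P i * ‖y - v‖)
    (ystar : EuclideanSpace ℝ (Fin M)) (hystar : ystar ∈ DySPGC.optSet g h)
    (hbdd : ∃ C : ℝ, ∀ a ∈ DySPGC.effDom (DySPGC.hSum h), ∀ b ∈ DySPGC.effDom (DySPGC.hSum h),
      DySPGC.l2norm (a - b) ≤ C)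
    -- penalties and proximal weights
    (pen : G.Dart → ℝ) (hpen : ∀ e, 0 < pen e) (om : V → ℝ) (hom : ∀ i, 0 ≤ om i)
    (hstep : ((2 : ℝ) • DySPGC.nodeDiag M om
      + DySPGC.Mplus G M * DySPGC.XiI M pen * (DySPGC.Mplus G M)ᵀ
      - (2 : ℝ) • DySPGC.nodeDiag M P).PosDef)
    (eta : ℕ → ℝ) (heta : ∀ r : ℕ, eta (r + 1) = Real.sqrt ((r : ℝ) + 1))
    -- the stochastic gradients
    {Ω : Type*} [MeasurableSpace Ω] (μ : Measure Ω) [IsProbabilityMeasure μ]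
    {S : V → Type*} [∀ i, MeasurableSpace (S i)]
    (gt : ∀ i, EuclideanSpace ℝ (Fin M) → S i → EuclideanSpace ℝ (Fin M))
    (hgt_meas : ∀ i, Measurable (Function.uncurry (gt i)))
    (xi : ℕ → Ω → ∀ i, S i) (hxi_meas : ∀ r, Measurable (xi (r + 1)))
    (hxi_indep : iIndepFun (fun r => xi (r + 1)) μ)
    (hunbiased : ∀ r i, ∀ y ∈ DySPGC.effDom (h i),
      Integrable (fun w => gt i y (xi (r + 1) w i)) μ ∧
        ∫ w, gt i y (xi (r + 1) w i) ∂μ = gradient (g i) y)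
    (σ : ℝ)
    (hvar : ∀ r, ∀ a ∈ DySPGC.effDom (DySPGC.hSum h),
      Integrable (fun w => DySPGC.l2norm
        (DySPGC.stochGrad gt a (xi (r + 1) w) - DySPGC.gradVec g a) ^ 2) μ ∧
      ∫ w, DySPGC.l2norm
        (DySPGC.stochGrad gt a (xi (r + 1) w) - DySPGC.gradVec g a) ^ 2 ∂μ ≤ σ ^ 2)
    -- a run of the algorithm
    (x0 : V × Fin M → ℝ) (z0 : G.Dart × Fin M → ℝ)
    (l0 : (G.Dart × Fin M) ⊕ (G.Dart × Fin M) → ℝ)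
    (hx0 : x0 ∈ DySPGC.effDom (DySPGC.hSum h))
    (x : ℕ → Ω → V × Fin M → ℝ) (z : ℕ → Ω → G.Dart × Fin M → ℝ)
    (l : ℕ → Ω → (G.Dart × Fin M) ⊕ (G.Dart × Fin M) → ℝ)
    (hrun : DySPGC.IsRun h gt pen om eta xi x0 z0 l0 x z l)
    (rho : ℝ) (hrho : 0 < rho) (r : ℕ) (hr : 0 < r) :
    (∀ w, DySPGC.avg x r w ∈ DySPGC.effDom (DySPGC.hSum h)) ∧
    Integrable (fun w => DySPGC.gap G g h rho ystar (DySPGC.avg x r w) (DySPGC.avg z r w)) μ ∧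
    ∫ w, DySPGC.gap G g h rho ystar (DySPGC.avg x r w) (DySPGC.avg z r w) ∂μ ≤
      σ ^ 2 / Real.sqrt r
      + DySPGC.dX (DySPGC.effDom (DySPGC.hSum h)) ^ 2 / (2 * Real.sqrt r)
      + 1 / (2 * (r : ℝ)) * (DySPGC.dZ pen (DySPGC.effDom (DySPGC.hSum h)) ^ 2
          + DySPGC.dLam pen l0 rho ^ 2
          + (⨆ i, om i) * DySPGC.dX (DySPGC.effDom (DySPGC.hSum h)) ^ 2) := by
  have hy := DySPGC.copies_mem_effDom hh_bot hystar
  have heta_pos : ∀ r, 0 < eta (r + 1) := fun r => by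
    rw [heta]; exact Real.sqrt_pos.2 (by positivity)
  have hmeas : ∀ t, Measurable (x t) ∧ Measurable (z t) ∧ Measurable (l t) := fun t =>
    hrun.measurable_iterates hgt_meas hpen hom hh_bot hh_convex heta_pos hx0 t
      fun s _ => hxi_meas s
  have hdom := hrun.mem_dom hpen hx0
  have havg := hrun.avg_mem_dom hh_bot hh_convex hpen hx0 hr
  have hind := hrun.indepFun_x hgt_meas hpen hom hh_bot hh_convex heta_pos hx0 hxi_meas hxi_indep
  have hsq := fun t => DySPGC.integral_error_sq_le hgt_meas (hxi_meas t) (hmeas t).1 (hind t)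
    (hdom t) (hvar t)
  have hcross := fun t => DySPGC.integral_error_dotProduct_eq_zero hh_bot hgt_meas (hxi_meas t)
    (hmeas t).1 (hind t) (hdom t) (hunbiased t) (hsq t).1 (DySPGC.copies V ystar)
    fun w => DySPGC.l2norm_sub_le_dX hbdd (hdom t w) hy
  have hbound := hrun.gap_avg_le hg_convex hg_diff hh_bot hh_convex hg_lip hy hbdd hpen hom hstep
    heta hx0 hrho.le hr
  have hint₁ := integrable_finsetSum (Finset.range r) fun t _ => (hcross t).1
  have hint₂ := integrable_finsetSum (Finset.range r) fun t _ =>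
    (hsq t).1.const_mul (1 / (2 * Real.sqrt ((t : ℝ) + 1)))
  obtain ⟨hint, hintegral⟩ := DySPGC.integrable_and_integral_affine hint₁ hint₂ (1 / (r : ℝ))
    (Real.sqrt r / 2 * DySPGC.dX (DySPGC.effDom (DySPGC.hSum h)) ^ 2)
    (1 / 2 * (DySPGC.dZ pen (DySPGC.effDom (DySPGC.hSum h)) ^ 2 + DySPGC.dLam pen l0 rho ^ 2
      + (⨆ i, om i) * DySPGC.dX (DySPGC.effDom (DySPGC.hSum h)) ^ 2))
  have : Nonempty Ω := nonempty_of_isProbabilityMeasure μ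
  obtain ⟨K, hK⟩ := hrun.exists_le_fSum hg_diff hh_bot hbdd hpen hx0
  have hgap : Integrable
      (fun w => DySPGC.gap G g h rho ystar (DySPGC.avg x r w) (DySPGC.avg z r w)) μ := by
    -- The gap lies between a constant and the integrable pathwise bound.
    refine integrable_of_le_of_le (DySPGC.measurable_gap_comp hg_diff hh_bot hh_meas rho ystar
      (DySPGC.measurable_avg (fun t => (hmeas t).1) r)
      (DySPGC.measurable_avg (fun t => (hmeas t).2.1) r) havg).aestronglyMeasurable
      (.of_forall fun w => ?_) (.of_forall hbound)
      (integrable_const (K - (DySPGC.fSum g h (DySPGC.copies V ystar)).toReal)) hint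
    have h₁ := hK _ (havg w)
    have h₂ := mul_nonneg hrho.le (DySPGC.l2norm_nonneg
      (DySPGC.A G M *ᵥ DySPGC.avg x r w + DySPGC.B G M *ᵥ DySPGC.avg z r w))
    simp only [DySPGC.gap]
    linarith
  refine ⟨havg, hgap, (integral_mono hgap hint hbound).trans ?_⟩
  have hnoise : ∑ t ∈ Finset.range r, ∫ w, 1 / (2 * Real.sqrt ((t : ℝ) + 1)) * DySPGC.l2norm
        (DySPGC.stochGrad gt (x t w) (xi (t + 1) w) - DySPGC.gradVec g (x t w)) ^ 2 ∂μ
      ≤ Real.sqrt r * σ ^ 2 := by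
    refine le_trans (Finset.sum_le_sum fun t _ => ?_)
      ((Finset.sum_mul _ _ _).symm.trans_le
        (mul_le_mul_of_nonneg_right (DySPGC.sum_inv_sqrt_le r) (sq_nonneg σ)))
    rw [integral_const_mul]
    exact mul_le_mul_of_nonneg_left (hsq t).2 (by positivity)
  -- The cross terms have mean zero; only the squared errors, bounded in `hnoise`, and the
  -- deterministic constants survive.
  rw [hintegral, integral_finsetSum _ fun t _ => (hcross t).1,
    integral_finsetSum _ fun t _ => (hsq t).1.const_mul _,
    Finset.sum_eq_zero fun t _ => (hcross t).2, zero_add]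
  have hr' : (0 : ℝ) < r := by positivity
  have hs : 0 < Real.sqrt r := Real.sqrt_pos.2 hr'
  have hss : 1 / (r : ℝ) * Real.sqrt r = 1 / Real.sqrt r := by
    rw [one_div_mul_eq_div, Real.sqrt_div_self']
  have hfin := mul_le_mul_of_nonneg_left hnoise (one_div_pos.2 hr').le
  rw [← mul_assoc, hss] at hfin
  rw [mul_add, mul_add, show ∀ d : ℝ, 1 / (r : ℝ) * (Real.sqrt r / 2 * d)
    = (1 / (r : ℝ) * Real.sqrt r) * (d / 2) from fun d => by ring, hss]
  refine (add_le_add_left (add_le_add_left hfin _) _).trans_eq ?_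
  field_simp
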